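/- Let $X$ be a locally finite $\mathrm{CAT}(0)$ cube complex with vertex set $X^{(0)}$, and let $\mathrm{Aut}(X)$ be its group of cubical automorphisms with the compact-open topology. Let $\mathrm{Aut}^{+}(X)$ be the subgroup of $\mathrm{Aut}(X)$ generated by all elements that fix some halfspace of $X$ pointwise, with the subspace topology. Let $\Sigma_0$ be a finite set with a fixpoint free involution $s \mapsto s^{-1}$. An admissible edge labeling is a map $\ell$ from the oriented edges of $X$ to $\Sigma_0$ such that: (A1) parallel oriented edges have the same label, and reversing the orientation of an edge inverts its label; (A2) distinct oriented edges with the same initial vertex have distinct labels; (A3) if $e_1, e_2$ are oriented edges with initial vertex $v$ and $e_1', e_2'$ are oriented edges with initial vertex $w$ such that $\ell(e_1) = \ell(e_1')$ and $\ell(e_2) = \ell(e_2')$, then $e_1, e_2$ span a square if and only if $e_1', e_2'$ span a square. Here two edges span a square if they have exactly one endpoint in common and the hyperplanes they cross are distinct and intersect. Two labels $s, t \in \Sigma_0$ commute, written $[s,t] = 1$, if there are oriented edges with a common initial vertex and labels $s$ and $t$ that span a square. Let $\Gamma$ be a group acting on $X$ by cubical automorphisms, transitively on $X^{(0)}$,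 and let $\ell$ be an admissible edge labeling of $X$ that is $\Gamma$-invariant, i.e. $\ell(g e) = \ell(e)$ for all $g \in \Gamma$ and all oriented edges $e$. Suppose there is some $s \in \Sigma_0$ which is the label of at least one oriented edge, such that for any two distinct $t, r \in \Sigma_0$ with $[s,t] = [s,r] = 1$ we have $t = r^{-1}$ or $[t,r] = 1$. Then $\mathrm{Aut}^{+}(X)$ is locally compact. Moreover, there is a finite set $K \subset X^{(0)}$ such that every element of $\mathrm{Aut}(X)$ that fixes every vertex in $K$ lies in $\mathrm{Aut}^{+}(X)$. -/

import Mathlib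

/-!
# Cube complexes, their automorphism groups, and admissible edge labelings

A cube complex is encoded by its vertex set `V` together with the collection of the vertex sets
of its cubes. Every cube is embedded, and two cubes meet in a common face or not at all; every
CAT(0) cube complex is of this kind.
-/

/-- `φ` identifies the vertex set of the standard cube `[0,1]^n` with `C`, and the members of
`cubes` which are contained in `C` are exactly the images of the (nonempty) faces of the standard
cube. A face is a product of nonempty subsets of `{0,1}`. -/
structure IsCubeChart {V : Type*} (cubes : Set (Set V)) (C : Set V) {n : ℕ}
    (φ : (Fin n → Bool) → V) : Prop where
  injective : Function.Injective φ
  range_eq : Set.range φ = C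
  mem_iff_face : ∀ D : Set V, D ⊆ C →
    (D ∈ cubes ↔ ∃ A : Fin n → Set Bool, (∀ i, (A i).Nonempty) ∧ D = φ '' Set.univ.pi A)

/-- A cube complex with vertex set `V`. The elements of `cubes` are the vertex sets of cubes. -/
structure CubeComplex (V : Type*) where
  cubes : Set (Set V)
  singleton_mem : ∀ v : V, {v} ∈ cubes
  exists_chart : ∀ C ∈ cubes, ∃ (n : ℕ) (φ : (Fin n → Bool) → V), IsCubeChart cubes C φ
  inter_mem : ∀ C ∈ cubes, ∀ D ∈ cubes, (C ∩ D).Nonempty → C ∩ D ∈ cubes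

namespace CubeComplex

variable {V : Type*} (X : CubeComplex V)

/-- Every vertex lies in only finitely many cubes. -/
def LocallyFinite : Prop := ∀ v : V, {C | C ∈ X.cubes ∧ v ∈ C}.Finite

/-! ### Geometric realization -/

/-- The point with coordinates `x ∈ [0,1]^n` in the cube parametrized by `φ`, encoded by its
multilinear barycentric coordinates: the weight of the vertex `φ b` is the product over `i` of
`x i` (if `b i = 1`) and `1 - x i` (if `b i = 0`), and vertices outside of the cube have
weight zero. -/
noncomputable def cubePoint {n : ℕ} (φ : (Fin n → Bool) → V) (x : Fin n → ℝ) : V → ℝ :=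
  Function.extend φ (fun b => ∏ i, if b i then x i else 1 - x i) 0

/-- The geometric realization of `X`: the union of all its (solid) cubes. -/
def Realization : Type _ :=
  {p : V → ℝ // ∃ (n : ℕ) (φ : (Fin n → Bool) → V) (x : Fin n → ℝ),
    (∃ C ∈ X.cubes, IsCubeChart X.cubes C φ) ∧ (∀ i, x i ∈ Set.Icc (0 : ℝ) 1) ∧
      p = cubePoint φ x}

/-- The topology of convergence of all barycentric coordinates. On each cube it is the Euclidean
topology, and if `X` is locally finite, then it is the usual (weak, or equivalently metric)
topology on the realization. -/
instance : TopologicalSpace X.Realization :=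
  inferInstanceAs (TopologicalSpace {p : V → ℝ // ∃ (n : ℕ) (φ : (Fin n → Bool) → V)
    (x : Fin n → ℝ), (∃ C ∈ X.cubes, IsCubeChart X.cubes C φ) ∧
      (∀ i, x i ∈ Set.Icc (0 : ℝ) 1) ∧ p = cubePoint φ x})

/-! ### Nonpositive curvature -/

/-- The `1`-skeleton of `X`. -/
def skeleton : SimpleGraph V where
  Adj v w := v ≠ w ∧ {v, w} ∈ X.cubes
  symm := ⟨fun v w h => ⟨h.1.symm, by rw [Set.pair_comm]; exact h.2⟩⟩
  loopless := ⟨fun _ h => h.1 rfl⟩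

/-- The link of every vertex `v` is a flag simplicial complex: if `N` is a finite set of neighbours
of `v` such that the edges from `v` to any two of them lie in a common cube, then the edges from
`v` to all elements of `N` lie in a common cube. -/
def FlagLinks : Prop :=
  ∀ (v : V) (N : Set V), N.Finite → (∀ a ∈ N, X.skeleton.Adj v a) →
    (∀ a ∈ N, ∀ b ∈ N, ∃ C ∈ X.cubes, v ∈ C ∧ a ∈ C ∧ b ∈ C) →
      ∃ C ∈ X.cubes, v ∈ C ∧ N ⊆ C

/-- A (locally finite) cube complex is CAT(0) if it is simply connected and all its vertex links
are flag complexes. -/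
structure IsCAT0 : Prop where
  simplyConnected : SimplyConnectedSpace X.Realization
  flagLinks : X.FlagLinks

/-! ### Oriented edges, hyperplanes and halfspaces -/

/-- Oriented edges. The edge `e` goes from `e.fst` to `e.snd`, and `e.symm` is the same geometric
edge with the opposite orientation. -/
abbrev OEdge : Type _ := X.skeleton.Dart

/-- `a, b, c, d` are the vertices of a square of `X`, in cyclic order. -/
def IsSquare (a b c d : V) : Prop :=
  X.skeleton.Adj a b ∧ X.skeleton.Adj b c ∧ X.skeleton.Adj c d ∧ X.skeleton.Adj d a ∧
    a ≠ c ∧ b ≠ d ∧ {a, b, c, d} ∈ X.cubes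

variable {X} in
/-- Parallelism of oriented edges: the equivalence relation generated by identifying opposite,
equally oriented edges of squares. -/
def Parallel : X.OEdge → X.OEdge → Prop :=
  Relation.EqvGen fun e f => X.IsSquare e.fst e.snd f.snd f.fst

variable {X} in
/-- The oriented edges `e` and `f` cross the same hyperplane. -/
def SameHyperplane (e f : X.OEdge) : Prop := Parallel e f ∨ Parallel e f.symm

variable {X} in
/-- The hyperplanes crossed by `e` and `e'` intersect transversally: they are distinct and there
is a square with a corner at which one edge crosses the first hyperplane and the other edge
crosses the second one. -/
def Transverse (e e' : X.OEdge) : Prop :=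
  ¬ SameHyperplane e e' ∧ ∃ f f' : X.OEdge, f.fst = f'.fst ∧
    (∃ w, X.IsSquare f.fst f.snd w f'.snd) ∧ SameHyperplane e f ∧ SameHyperplane e' f'

variable {X} in
/-- Two edges span a square if they have precisely one endpoint in common and the hyperplanes they
cross intersect transversally. -/
def SpanSquare (e e' : X.OEdge) : Prop :=
  (∃! v : V, v ∈ e.edge ∧ v ∈ e'.edge) ∧ Transverse e e'

variable {X} in
/-- The (vertex set of the) halfspace bounded by the hyperplane crossed by `e` that contains the
endpoint of `e`: all vertices that can be joined to `e.snd` by an edge path which does not cross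
this hyperplane. -/
def halfspace (e : X.OEdge) : Set V :=
  {v | Relation.ReflTransGen
    (fun a b => ∃ f : X.OEdge, f.fst = a ∧ f.snd = b ∧ ¬ SameHyperplane e f) e.snd v}

/-- `h` is a halfspace of `X`. -/
def IsHalfspace (h : Set V) : Prop := ∃ e : X.OEdge, h = halfspace e

/-! ### The automorphism group -/

/-- The permutations of the vertices that send cubes to cubes, as do their inverses. -/
def autGroup : Subgroup (Equiv.Perm V) where
  carrier := {g | ∀ C : Set V, g '' C ∈ X.cubes ↔ C ∈ X.cubes}
  one_mem' := by intro C; simp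
  mul_mem' := by
    intro g h hg hh C
    have : (⇑(g * h) : V → V) '' C = g '' (h '' C) := by
      rw [Set.image_image]; rfl
    rw [this, hg, hh]
  inv_mem' := by
    intro g hg C
    rw [← hg ((⇑g⁻¹ : V → V) '' C), Set.image_image]
    simp

/-- The group `Aut(X)` of automorphisms of `X`. -/
def Aut : Type _ := X.autGroup

instance : Group X.Aut := inferInstanceAs (Group X.autGroup)

instance : MulAction X.Aut V := inferInstanceAs (MulAction X.autGroup V)

variable {X}

theorem Aut.image_mem_iff (g : X.Aut) (C : Set V) :
    (fun v => g • v) '' C ∈ X.cubes ↔ C ∈ X.cubes := g.2 C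

theorem Aut.isCubeChart (g : X.Aut) {C : Set V} {n : ℕ} {φ : (Fin n → Bool) → V}
    (h : IsCubeChart X.cubes C φ) :
    IsCubeChart X.cubes ((fun v => g • v) '' C) (fun b => g • φ b) where
  injective := (MulAction.injective g).comp h.injective
  range_eq := by rw [← h.range_eq, ← Set.range_comp]; rfl
  mem_iff_face := by
    intro D hD
    obtain ⟨D, rfl⟩ : ∃ D', D = (fun v => g • v) '' D' :=
      ⟨(fun v => g • v) ⁻¹' D,
        (Set.image_preimage_eq D (MulAction.surjective g)).symm⟩
    have hD' : D ⊆ C := (Set.image_subset_image_iff (MulAction.injective g)).1 hD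
    rw [g.image_mem_iff, h.mem_iff_face D hD']
    refine exists_congr fun A => and_congr_right fun _ => ?_
    rw [show (fun b => g • φ b) '' Set.univ.pi A = (fun v => g • v) '' (φ '' Set.univ.pi A) by
      rw [Set.image_image], (MulAction.injective g).image_injective.eq_iff]

/-- The homeomorphism (here: continuous map) of the realization induced by an automorphism; it maps the point of the cube
`φ` with coordinates `x` to the point of the cube `g ∘ φ` with coordinates `x`. -/
def Aut.realize (g : X.Aut) : C(X.Realization, X.Realization) where
  toFun p := ⟨fun v => p.1 (g⁻¹ • v), by
    obtain ⟨p, n, φ, x, ⟨C, hC, hφ⟩, hx, rfl⟩ := p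
    refine ⟨n, fun b => g • φ b, x, ⟨_, (g.image_mem_iff C).2 hC, g.isCubeChart hφ⟩, hx, ?_⟩
    have hinj : Function.Injective fun b => g • φ b :=
      (MulAction.injective g).comp hφ.injective
    funext v
    obtain ⟨w, rfl⟩ := MulAction.surjective g v
    simp only [cubePoint, inv_smul_smul]
    by_cases hw : ∃ b, φ b = w
    · obtain ⟨b, rfl⟩ := hw
      rw [hφ.injective.extend_apply]
      exact (hinj.extend_apply (fun b => ∏ i, if b i = true then x i else 1 - x i) 0 b).symm
    · rw [Function.extend_apply' _ _ _ hw, Function.extend_apply' _ _ _ (by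
        rintro ⟨b, hb⟩
        exact hw ⟨b, MulAction.injective g hb⟩)]
      rfl⟩
  continuous_toFun := by
    refine Continuous.subtype_mk (continuous_pi fun v => ?_) _
    exact (continuous_apply (g⁻¹ • v)).comp continuous_subtype_val

/-- `Aut(X)` carries the compact-open topology, as a group of homeomorphisms of the realization. -/
instance : TopologicalSpace X.Aut :=
  TopologicalSpace.induced Aut.realize ContinuousMap.compactOpen

/-- The action of automorphisms on oriented edges. -/
def Aut.mapEdge (g : X.Aut) (e : X.OEdge) : X.OEdge where
  toProd := (g • e.fst, g • e.snd)
  adj := ⟨fun h => e.adj.1 (MulAction.injective g h), by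
    have := (g.image_mem_iff {e.fst, e.snd}).2 e.adj.2
    rwa [Set.image_pair] at this⟩

variable (X) in
/-- The subgroup of `Aut(X)` generated by all elements that fix some halfspace pointwise. -/
def AutPlus : Subgroup X.Aut :=
  Subgroup.closure {g | ∃ h : Set V, X.IsHalfspace h ∧ ∀ v ∈ h, g • v = v}

/-! ### Admissible edge labelings -/

/-- `ℓ` is an admissible edge labeling with values in a set `S` that carries an involution
`s ↦ s⁻¹`. -/
structure IsAdmissible {S : Type*} [InvolutiveInv S] (ℓ : X.OEdge → S) : Prop where
  parallel : ∀ e f, Parallel e f → ℓ e = ℓ f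
  symm : ∀ e : X.OEdge, ℓ e.symm = (ℓ e)⁻¹
  injective : ∀ e f : X.OEdge, e.fst = f.fst → ℓ e = ℓ f → e = f
  square : ∀ e₁ e₂ f₁ f₂ : X.OEdge, e₁.fst = e₂.fst → f₁.fst = f₂.fst →
    ℓ e₁ = ℓ f₁ → ℓ e₂ = ℓ f₂ → (SpanSquare e₁ e₂ ↔ SpanSquare f₁ f₂)

/-- The labels `s` and `t` commute: there are two edges with these labels that emanate from the
same vertex and span a square. -/
def LabelsCommute {S : Type*} (ℓ : X.OEdge → S) (s t : S) : Prop :=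
  ∃ e f : X.OEdge, e.fst = f.fst ∧ SpanSquare e f ∧ ℓ e = s ∧ ℓ f = t

end CubeComplex

/-! Let `e` be an edge whose label is the distinguished `s`, and let `K` consist of its initial
vertex and all neighbours of that vertex. Suppose `g` fixes `K` pointwise.

Rigidity along the carrier. The property `FixesCarrierAt` (a vertex is fixed together with its
neighbours along `s` and along labels commuting with `s`) passes across squares of the carrier.
Three fixed vertices of a square force the fourth to be fixed, because labels at a vertex are
distinct and opposite edges carry equal labels. The commutation hypothesis on `s` supplies the
squares needed (`FixesCarrierAt.snd`). Hence `g` fixes both endpoints of every edge crossing the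
hyperplane of `e`.

Cutting. The hyperplane separates the vertices into two sides, and `g` preserves each side. Every
cube crossing the hyperplane is fixed pointwise, so `g` can be replaced by the identity on either
side. Thus `g` is a product of two automorphisms, each fixing a halfspace
(`mem_autPlus_of_fixes_hyperplane`).

Separation comes from simple connectedness. Giving sign `-1` to the edges crossing the hyperplane
defines a double cover of the realization. This cover is trivial, and a choice of sheet is a sign
function on vertices that changes exactly across the hyperplane (`IsEdgeSign.exists_potential`).

Topology. By local finiteness and connectedness, pointwise stabilizers of finite nonempty vertex
sets are compact and open. A subgroup containing one of them, such as `AutPlus`, is therefore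
locally compact. -/

/-- The projected path is a null-homotopic loop, so its lift ends where the lift of the constant
path does. -/
theorem IsCoveringMap.eq_of_joined {E B : Type*} [TopologicalSpace E] [TopologicalSpace B]
    [SimplyConnectedSpace B] {p : E → B} (hp : IsCoveringMap p) {x y : E} (h : Joined x y)
    (hxy : p x = p y) : x = y := by
  obtain ⟨γ⟩ := h
  let δ : Path (p x) (p x) := (γ.map hp.continuous).cast rfl hxy
  have hδ : δ.Homotopic (Path.refl (p x)) := SimplyConnectedSpace.paths_homotopic _ _
  have h₁ : (γ : C(unitInterval, E)) = hp.liftPath δ x δ.source :=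
    (hp.eq_liftPath_iff' _).2 ⟨rfl, γ.source⟩
  have h₂ : ContinuousMap.const unitInterval x = hp.liftPath (Path.refl (p x)) x rfl :=
    (hp.eq_liftPath_iff' _).2 ⟨rfl, rfl⟩
  have h₃ := hp.liftPath_apply_one_eq_of_homotopicRel hδ x δ.source rfl
  calc x = ContinuousMap.const unitInterval x 1 := rfl
    _ = (γ : C(unitInterval, E)) 1 := by rw [h₁, h₂]; exact h₃.symm
    _ = y := γ.target

/-! ### Barycentric coordinates on the realization. -/

namespace CubeComplex

section CubePoint

variable {V : Type*} {n : ℕ} {φ : (Fin n → Bool) → V}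

theorem cubePoint_apply (hφ : Function.Injective φ) (x : Fin n → ℝ) (b : Fin n → Bool) :
    cubePoint φ x (φ b) = ∏ i, if b i then x i else 1 - x i :=
  hφ.extend_apply _ _ _

theorem cubePoint_of_notMem_range (x : Fin n → ℝ) {v : V} (hv : v ∉ Set.range φ) :
    cubePoint φ x v = 0 :=
  Function.extend_apply' _ _ _ hv

theorem continuous_cubePoint (hφ : Function.Injective φ) : Continuous (cubePoint φ) := by
  refine continuous_pi fun v => ?_
  by_cases hv : v ∈ Set.range φ
  · obtain ⟨b, rfl⟩ := hv
    simp only [cubePoint_apply hφ]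
    refine continuous_finsetProd _ fun i _ => ?_
    split_ifs <;> fun_prop
  · simp only [cubePoint_of_notMem_range _ hv]
    exact continuous_const

open Classical in
theorem cubePoint_vertex (hφ : Function.Injective φ) (b : Fin n → Bool) (v : V) :
    cubePoint φ (fun i => if b i then 1 else 0) v = if v = φ b then 1 else 0 := by
  by_cases hv : v ∈ Set.range φ
  · obtain ⟨c, rfl⟩ := hv
    rw [cubePoint_apply hφ]
    split_ifs with h
    · rw [hφ h]
      exact Finset.prod_eq_one fun i _ => by cases b i <;> simp
    · obtain ⟨i, hi⟩ : ∃ i, c i ≠ b i := by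
        by_contra! hc
        exact h (congrArg φ (funext hc))
      refine Finset.prod_eq_zero (Finset.mem_univ i) ?_
      cases hb : b i <;> cases hc : c i <;> simp_all
  · rw [cubePoint_of_notMem_range _ hv, if_neg]
    rintro rfl
    exact hv ⟨b, rfl⟩

end CubePoint

variable {V : Type*} {X : CubeComplex V}

namespace Realization

theorem continuous_coord (v : V) : Continuous fun p : X.Realization => p.1 v :=
  (continuous_apply v).comp continuous_subtype_val

theorem nonneg (p : X.Realization) (v : V) : 0 ≤ p.1 v := by
  obtain ⟨p, n, φ, x, ⟨C, hC, hφ⟩, hx, rfl⟩ := p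
  by_cases hv : v ∈ Set.range φ
  · obtain ⟨b, rfl⟩ := hv
    simp only [cubePoint_apply hφ.injective]
    refine Finset.prod_nonneg fun i _ => ?_
    split_ifs
    · exact (hx i).1
    · exact sub_nonneg.2 (hx i).2
  · exact (cubePoint_of_notMem_range _ hv).ge

theorem exists_pos (p : X.Realization) : ∃ v, 0 < p.1 v := by
  obtain ⟨p, n, φ, x, ⟨C, hC, hφ⟩, hx, rfl⟩ := p
  refine ⟨φ fun i => decide (0 < x i), ?_⟩
  simp only [cubePoint_apply hφ.injective]
  refine Finset.prod_pos fun i _ => ?_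
  by_cases h : 0 < x i
  · simp [h]
  · have : x i = 0 := le_antisymm (not_lt.1 h) (hx i).1
    simp [this]

theorem exists_cube (p : X.Realization) : ∃ C ∈ X.cubes, ∀ v, p.1 v ≠ 0 → v ∈ C := by
  obtain ⟨p, n, φ, x, ⟨C, hC, hφ⟩, hx, rfl⟩ := p
  refine ⟨C, hC, fun v hv => ?_⟩
  by_contra h
  rw [← hφ.range_eq] at h
  exact hv (cubePoint_of_notMem_range _ h)

open Classical in
/-- The vertex `v`, as a point of the realization. -/
noncomputable def vertex (X : CubeComplex V) (v : V) : X.Realization :=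
  ⟨fun w => if w = v then 1 else 0, by
    obtain ⟨n, φ, hφ⟩ := X.exists_chart _ (X.singleton_mem v)
    have hv : v ∈ Set.range φ := by rw [hφ.range_eq]; rfl
    obtain ⟨b, rfl⟩ := hv
    refine ⟨n, φ, fun i => if b i then 1 else 0, ⟨_, X.singleton_mem _, hφ⟩, fun i => ?_,
      funext fun w => (cubePoint_vertex hφ.injective b w).symm⟩
    dsimp only
    split_ifs <;> simp⟩

end Realization

/-! ### Two-sheeted coverings defined by sign cocycles -/

/-- `σ v w` is a sign for any two vertices of a common cube, and these signs satisfy the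
cocycle condition on every cube. -/
structure IsSignCocycle (X : CubeComplex V) (σ : V → V → ℝ) : Prop where
  sign : ∀ C ∈ X.cubes, ∀ v ∈ C, ∀ w ∈ C, σ v w = 1 ∨ σ v w = -1
  mul : ∀ C ∈ X.cubes, ∀ u ∈ C, ∀ v ∈ C, ∀ w ∈ C, σ u v * σ v w = σ u w

/-- The double cover of the realization whose sheets are glued according to `σ`: a point is a
point of the realization together with signs of its coordinates that are compatible with `σ`. -/
abbrev DoubleCover (X : CubeComplex V) (σ : V → V → ℝ) : Type _ :=
  {q : V → ℝ // (∃ p : X.Realization, p.1 = fun v => |q v|) ∧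
    ∀ v w, q w * |q v| = σ v w * (q v * |q w|)}

namespace DoubleCover

variable {σ : V → V → ℝ}

/-- The projection of the double cover to the realization. -/
noncomputable def proj (q : DoubleCover X σ) : X.Realization :=
  ⟨fun v => |q.1 v|, q.2.1.choose_spec ▸ q.2.1.choose.2⟩

theorem continuous_proj : Continuous (proj : DoubleCover X σ → X.Realization) := by
  refine Continuous.subtype_mk (continuous_pi fun v => ?_) _
  exact ((continuous_apply v).comp continuous_subtype_val).abs

/-- The sign `±1` encoded by a boolean. -/
def boolSign (b : Bool) : ℝ := if b then 1 else -1

theorem abs_boolSign (b : Bool) : |boolSign b| = 1 := by cases b <;> simp [boolSign]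

/-- Only vertices in the support of `p` matter. They lie in one cube, where the cocycle identity
applies. -/
theorem ofSign_aux (hσ : X.IsSignCocycle σ) (p : X.Realization) (v : V) (hv : p.1 v ≠ 0)
    (ε : ℝ) (hε : |ε| = 1) :
    (fun w => |ε * (σ v w * p.1 w)|) = p.1 ∧ ∀ u w, (ε * (σ v w * p.1 w)) * p.1 u =
      σ u w * ((ε * (σ v u * p.1 u)) * p.1 w) := by
  obtain ⟨C, hC, hp⟩ := p.exists_cube
  constructor
  · funext w
    by_cases hw : p.1 w = 0
    · simp [hw]
    · rw [abs_mul, abs_mul, hε, abs_of_nonneg (p.nonneg w)]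
      rcases hσ.sign C hC v (hp v hv) w (hp w hw) with h | h <;> simp [h]
  · intro u w
    by_cases hw : p.1 w = 0
    · simp [hw]
    by_cases hu : p.1 u = 0
    · simp [hu]
    rw [← hσ.mul C hC v (hp v hv) u (hp u hu) w (hp w hw)]
    ring

/-- The point of the double cover over `p` whose `v`-coordinate has the given sign. -/
noncomputable def ofSign (hσ : X.IsSignCocycle σ) (p : X.Realization) (v : V) (hv : p.1 v ≠ 0)
    (ε : ℝ) (hε : |ε| = 1) :
    DoubleCover X σ :=
  ⟨fun w => ε * (σ v w * p.1 w), ⟨p, (ofSign_aux hσ p v hv ε hε).1.symm⟩, fun u w => by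
    have h := ofSign_aux hσ p v hv ε hε
    have h₁ := congrFun h.1
    dsimp only at h₁ ⊢
    rw [h₁, h₁]
    exact h.2 u w⟩

theorem proj_ofSign (hσ : X.IsSignCocycle σ) (p : X.Realization) (v : V) (hv : p.1 v ≠ 0)
    (ε : ℝ) (hε : |ε| = 1) :
    (ofSign hσ p v hv ε hε).proj = p :=
  Subtype.ext (ofSign_aux hσ p v hv ε hε).1

theorem sigma_self (hσ : X.IsSignCocycle σ) (v : V) : σ v v = 1 := by
  have h := hσ.mul _ (X.singleton_mem v) v rfl v rfl v rfl
  rcases hσ.sign _ (X.singleton_mem v) v rfl v rfl with h' | h' <;> rw [h'] at h ⊢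
  norm_num at h

/-- Over the open set where the `v`-coordinate is positive, the sign of that coordinate upstairs
names the sheet and, through `σ`, determines all other signs. -/
theorem isCoveringMap_proj (hσ : X.IsSignCocycle σ) :
    IsCoveringMap (proj : DoubleCover X σ → X.Realization) := by
  intro p
  obtain ⟨v, hv⟩ := p.exists_pos
  refine IsEvenlyCovered.to_isEvenlyCovered_preimage (I := Bool) ⟨inferInstance,
    {p | 0 < p.1 v}, hv, isOpen_lt continuous_const (Realization.continuous_coord v),
    (isOpen_lt continuous_const (Realization.continuous_coord v)).preimage continuous_proj, ?_⟩
  have hc : ∀ w, Continuous fun q : proj (σ := σ) ⁻¹' {p : X.Realization | 0 < p.1 v} =>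
      q.1.1 w := fun w =>
    (continuous_apply w).comp (continuous_subtype_val.comp continuous_subtype_val)
  have hne : ∀ q : proj (σ := σ) ⁻¹' {p : X.Realization | 0 < p.1 v}, q.1.1 v ≠ 0 := fun q =>
    abs_pos.1 q.2
  refine ⟨{ toFun := fun q => (⟨q.1.proj, q.2⟩, decide (0 < q.1.1 v))
            invFun := fun r => ⟨ofSign hσ r.1.1 v r.1.2.ne' (boolSign r.2) (abs_boolSign _), by
              rw [Set.mem_preimage, proj_ofSign]; exact r.1.2⟩
            left_inv := ?_
            right_inv := ?_
            continuous_toFun := ?_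
            continuous_invFun := ?_ }, fun q => rfl⟩
  · intro q
    refine Subtype.ext (Subtype.ext (funext fun w => ?_))
    have h := q.1.2.2 v w
    have hq := hne q
    change boolSign (decide (0 < q.1.1 v)) * (σ v w * |q.1.1 w|) = q.1.1 w
    rcases lt_or_gt_of_ne hq with hq' | hq'
    · rw [abs_of_neg hq'] at h
      have : decide (0 < q.1.1 v) = false := decide_eq_false hq'.not_gt
      rw [this]
      simp only [boolSign]
      have : q.1.1 v * (q.1.1 w + σ v w * |q.1.1 w|) = 0 := by linear_combination -h
      rcases mul_eq_zero.1 this with h' | h'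
      · exact absurd h' hq
      · simp only [Bool.false_eq_true, if_false]; linear_combination -h'
    · rw [abs_of_pos hq'] at h
      have : decide (0 < q.1.1 v) = true := decide_eq_true hq'
      rw [this]
      simp only [boolSign]
      have : q.1.1 v * (q.1.1 w - σ v w * |q.1.1 w|) = 0 := by linear_combination h
      rcases mul_eq_zero.1 this with h' | h'
      · exact absurd h' hq
      · simp only [if_true]; linear_combination -h'
  · rintro ⟨⟨r, hr⟩, b⟩
    have hr' : 0 < r.1 v := hr
    refine Prod.ext (Subtype.ext (proj_ofSign hσ r v hr'.ne' (boolSign b) (abs_boolSign b))) ?_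
    change decide (0 < boolSign b * (σ v v * r.1 v)) = b
    rw [sigma_self hσ, one_mul]
    cases b
    · simp [boolSign, hr'.le]
    · simp [boolSign, hr']
  · refine Continuous.prodMk ((continuous_proj.comp continuous_subtype_val).subtype_mk _) ?_
    refine continuous_bool_rng true |>.2 ⟨?_, ?_⟩
    -- The `v`-coordinate never vanishes here, so positivity is a closed condition as well as an
    -- open one.
    · have : (fun q : proj (σ := σ) ⁻¹' {p : X.Realization | 0 < p.1 v} =>
          decide (0 < q.1.1 v)) ⁻¹' {true} = {q | 0 ≤ q.1.1 v} := by
        ext q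
        simpa using (hne q).symm.le_iff_lt.symm
      rw [this]
      exact isClosed_le continuous_const (hc v)
    · have : (fun q : proj (σ := σ) ⁻¹' {p : X.Realization | 0 < p.1 v} =>
          decide (0 < q.1.1 v)) ⁻¹' {true} = {q | 0 < q.1.1 v} := by
        ext q
        simp
      rw [this]
      exact isOpen_lt continuous_const (hc v)
  · refine Continuous.subtype_mk (Continuous.subtype_mk (continuous_pi fun w => ?_) _) _
    have h₁ : Continuous boolSign := continuous_of_discreteTopology
    exact (h₁.comp continuous_snd).mul (continuous_const.mul
      ((Realization.continuous_coord w).comp (continuous_subtype_val.comp continuous_fst)))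

/-- A lift of the vertex `v` to the double cover. -/
noncomputable def vertex (hσ : X.IsSignCocycle σ) (v : V) (ε : ℝ)
    (hε : |ε| = 1) : DoubleCover X σ :=
  ofSign hσ (Realization.vertex X v) v (by simp [Realization.vertex]) ε hε

theorem vertex_apply_self (hσ : X.IsSignCocycle σ) (v : V) (ε : ℝ) (hε : |ε| = 1) :
    (vertex hσ v ε hε).1 v = ε := by
  simp [vertex, ofSign, Realization.vertex, sigma_self hσ]

theorem eq_vertex (hσ : X.IsSignCocycle σ) (v : V) (q : DoubleCover X σ)
    (hq : q.proj = Realization.vertex X v) :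
    ∃ hε : |q.1 v| = 1, q = vertex hσ v (q.1 v) hε := by
  have h : ∀ w, |q.1 w| = (Realization.vertex X v).1 w := fun w => by rw [← hq]; rfl
  have hε : |q.1 v| = 1 := by rw [h]; simp [Realization.vertex]
  refine ⟨hε, Subtype.ext (funext fun w => ?_)⟩
  by_cases hw : w = v
  · subst hw
    rw [vertex_apply_self]
  · have h0 := h w
    have hz : (Realization.vertex X v).1 w = 0 := by simp [Realization.vertex, hw]
    rw [hz, abs_eq_zero] at h0
    rw [h0]
    change 0 = q.1 v * (σ v w * (Realization.vertex X v).1 w)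
    rw [hz]
    ring

/-- The straight segment between the two corners of the cube lifts, with signs transported from `v`
by `σ`. -/
theorem vertex_joined (hσ : X.IsSignCocycle σ) {C : Set V} (hC : C ∈ X.cubes) {v w : V}
    (hv : v ∈ C) (hw : w ∈ C) (ε : ℝ)
    (hε : |ε| = 1) (hε' : |ε * σ v w| = 1) :
    Joined (vertex hσ v ε hε) (vertex hσ w (ε * σ v w) hε') := by
  obtain ⟨n, φ, hφ⟩ := X.exists_chart C hC
  obtain ⟨b, rfl⟩ : v ∈ Set.range φ := by rwa [hφ.range_eq]
  obtain ⟨c, rfl⟩ : w ∈ Set.range φ := by rwa [hφ.range_eq]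
  let x : unitInterval → Fin n → ℝ := fun t i =>
    (1 - (t : ℝ)) * (if b i then 1 else 0) + t * (if c i then 1 else 0)
  have hx : ∀ t i, x t i ∈ Set.Icc (0 : ℝ) 1 := by
    intro t i
    have h₀ := t.2.1
    have h₁ := t.2.2
    simp only [x]
    split_ifs <;> constructor <;> linarith
  let p : unitInterval → X.Realization := fun t =>
    ⟨cubePoint φ (x t), n, φ, x t, ⟨C, hC, hφ⟩, hx t, rfl⟩
  have hxc : Continuous x := by fun_prop
  have hpc : ∀ u, Continuous fun t => (p t).1 u := fun u =>
    (continuous_apply u).comp ((continuous_cubePoint hφ.injective).comp hxc)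
  have hsupp : ∀ t u, (p t).1 u ≠ 0 → u ∈ C := by
    intro t u hu
    by_contra h
    rw [← hφ.range_eq] at h
    exact hu (cubePoint_of_notMem_range _ h)
  have hp0 : p 0 = Realization.vertex X (φ b) := by
    refine Subtype.ext (funext fun u => ?_)
    have : x 0 = fun i => if b i then 1 else 0 := by funext i; simp [x]
    change cubePoint φ (x 0) u = _
    rw [this, cubePoint_vertex hφ.injective]
    rfl
  have hp1 : p 1 = Realization.vertex X (φ c) := by
    refine Subtype.ext (funext fun u => ?_)
    have : x 1 = fun i => if c i then 1 else 0 := by funext i; simp [x]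
    change cubePoint φ (x 1) u = _
    rw [this, cubePoint_vertex hφ.injective]
    rfl
  have habs : ∀ t u, |ε * (σ (φ b) u * (p t).1 u)| = (p t).1 u := by
    intro t u
    by_cases hu : (p t).1 u = 0
    · simp [hu]
    · rw [abs_mul, abs_mul, hε, abs_of_nonneg ((p t).nonneg u)]
      rcases hσ.sign C hC _ hv u (hsupp t u hu) with h | h <;> simp [h]
  let γ : unitInterval → DoubleCover X σ := fun t =>
    ⟨fun u => ε * (σ (φ b) u * (p t).1 u), ⟨p t, (funext (habs t)).symm⟩, fun u u' => by
      dsimp only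
      rw [habs, habs]
      by_cases h : (p t).1 u = 0
      · simp [h]
      by_cases h' : (p t).1 u' = 0
      · simp [h']
      rw [← hσ.mul C hC _ hv u (hsupp t u h) u' (hsupp t u' h')]
      ring⟩
  have hγ : Continuous γ := by
    refine Continuous.subtype_mk (continuous_pi fun u => ?_) _
    exact continuous_const.mul (continuous_const.mul (hpc u))
  refine ⟨⟨⟨γ, hγ⟩, ?_, ?_⟩⟩
  · refine Subtype.ext (funext fun u => ?_)
    change ε * (σ (φ b) u * (p 0).1 u) = _
    rw [hp0]
    rfl
  · refine Subtype.ext (funext fun u => ?_)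
    change ε * (σ (φ b) u * (p 1).1 u) = ε * σ (φ b) (φ c) * (σ (φ c) u * _)
    rw [hp1]
    by_cases hu : u = φ c
    · subst hu
      rw [sigma_self hσ]
      ring
    · have hz : (Realization.vertex X (φ c)).1 u = 0 := by simp [Realization.vertex, hu]
      rw [hz]
      ring

end DoubleCover

open DoubleCover in
/-- On a simply connected cube complex, every sign cocycle is a coboundary. -/
theorem IsSignCocycle.exists_potential [SimplyConnectedSpace X.Realization] {σ : V → V → ℝ}
    (hσ : X.IsSignCocycle σ) :
    ∃ f : V → ℝ, (∀ v, |f v| = 1) ∧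
      ∀ C ∈ X.cubes, ∀ v ∈ C, ∀ w ∈ C, f w = f v * σ v w := by
  obtain ⟨p₀⟩ : Nonempty X.Realization := inferInstance
  obtain ⟨v₀, -⟩ := p₀.exists_pos
  have hcov := isCoveringMap_proj hσ
  let q₀ := DoubleCover.vertex hσ v₀ 1 (by simp)
  -- The potential at `v` is the sign of a lift of `v` lying in the path component of `q₀`. By
  -- `IsCoveringMap.eq_of_joined` there is only one such lift.
  have h : ∀ v, ∃ (ε : ℝ) (hε : |ε| = 1), Joined q₀ (DoubleCover.vertex hσ v ε hε) := by
    intro v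
    let γ := PathConnectedSpace.somePath q₀.proj (Realization.vertex X v)
    let δ := hcov.liftPath γ q₀ γ.source
    have hδ : (δ 1).proj = Realization.vertex X v := by
      have := congrFun (hcov.liftPath_lifts γ q₀ γ.source) 1
      exact this.trans γ.target
    obtain ⟨hε, hv⟩ := eq_vertex hσ v _ hδ
    exact ⟨_, hε, ⟨⟨δ, hcov.liftPath_zero _ _ _, hv⟩⟩⟩
  choose f hf hj using h
  refine ⟨f, hf, fun C hC v hv w hw => ?_⟩
  have hε' : |f v * σ v w| = 1 := by
    rw [abs_mul, hf]
    rcases hσ.sign C hC v hv w hw with h | h <;> simp [h]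
  have hJ := (hj w).symm.trans ((hj v).trans (vertex_joined hσ hC hv hw (f v) (hf v) hε'))
  have := hcov.eq_of_joined hJ (by
    rw [DoubleCover.vertex, DoubleCover.vertex, proj_ofSign, proj_ofSign])
  rw [← vertex_apply_self hσ w (f w) (hf w), this, vertex_apply_self]

end CubeComplex

/-! ### Edges and squares inside a cube, and induction along edges. -/

theorem Function.update_induction {n : ℕ} {α : Type*} {P : (Fin n → α) → Prop}
    (h : ∀ a i x, P a → P (Function.update a i x)) {b : Fin n → α} (hb : P b) (c : Fin n → α) :
    P c := by
  classical
  have key : ∀ s : Finset (Fin n), P (s.piecewise c b) := by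
    intro s
    induction s using Finset.induction_on with
    | empty => simpa using hb
    | insert i s _ ih =>
      rw [Finset.piecewise_insert]
      exact h _ _ _ ih
  simpa using key Finset.univ

namespace CubeComplex

variable {V : Type*} {X : CubeComplex V}

section Chart

variable {C : Set V} {n : ℕ} {φ : (Fin n → Bool) → V}

theorem chart_adj (hφ : IsCubeChart X.cubes C φ) (b : Fin n → Bool) (i : Fin n)
    {x : Bool} (hx : x ≠ b i) : X.skeleton.Adj (φ b) (φ (Function.update b i x)) := by
  have hne : b ≠ Function.update b i x := fun h => hx (by
    have := congrFun h i
    rw [Function.update_self] at this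
    exact this.symm)
  refine ⟨fun h => hne (hφ.injective h), ?_⟩
  refine (hφ.mem_iff_face _ ?_).2 ⟨fun k => if k = i then Set.univ else {b k}, fun k => ?_, ?_⟩
  · rw [← hφ.range_eq]
    rintro _ (rfl | rfl) <;> exact ⟨_, rfl⟩
  · dsimp only
    split_ifs
    · exact Set.univ_nonempty
    · exact Set.singleton_nonempty _
  · rw [← Set.image_pair]
    congr 1
    ext d
    constructor
    · rintro (rfl | rfl) k - <;> by_cases hk : k = i <;> simp [hk]
    · intro hd
      have hd' : ∀ k, k ≠ i → d k = b k := fun k hk => by simpa [hk] using hd k trivial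
      by_cases hi : d i = b i
      · left
        funext k
        by_cases hk : k = i
        · rw [hk, hi]
        · exact hd' k hk
      · right
        funext k
        by_cases hk : k = i
        · subst hk
          rw [Function.update_self]
          revert hi hx
          cases d k <;> cases b k <;> cases x <;> simp
        · rw [Function.update_of_ne hk, hd' k hk]

/-- An edge is a face, hence a product set. Changing one differing coordinate of `b` to that of `c`
stays in the product `{b, c}`, so it already gives `c`. -/
theorem exists_update_of_chart_adj (hφ : IsCubeChart X.cubes C φ) {b c : Fin n → Bool}
    (h : X.skeleton.Adj (φ b) (φ c)) : ∃ i, c = Function.update b i (!b i) := by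
  have hne : b ≠ c := fun hbc => h.1 (congrArg φ hbc)
  obtain ⟨i, hi⟩ := Function.ne_iff.1 hne
  obtain ⟨A, -, hA⟩ := (hφ.mem_iff_face {φ b, φ c} (by
    rw [← hφ.range_eq]
    rintro _ (rfl | rfl) <;> exact ⟨_, rfl⟩)).1 h.2
  rw [← Set.image_pair] at hA
  have hA' := hφ.injective.image_injective hA
  have hb : b ∈ Set.univ.pi A := by rw [← hA']; simp
  have hc : c ∈ Set.univ.pi A := by rw [← hA']; simp
  have hm : Function.update b i (c i) ∈ ({b, c} : Set _) := by
    rw [hA']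
    intro k _
    by_cases hk : k = i
    · subst hk
      rw [Function.update_self]
      exact hc k trivial
    · rw [Function.update_of_ne hk]
      exact hb k trivial
  have hci : c i = !b i := by
    revert hi
    cases b i <;> cases c i <;> simp
  refine ⟨i, ?_⟩
  rcases hm with h' | h'
  · exact absurd (by rw [← h', Function.update_self]) hi
  · rw [← hci]
    exact (Set.mem_singleton_iff.1 h').symm

theorem chart_isSquare (hφ : IsCubeChart X.cubes C φ) (b : Fin n → Bool)
    {i j : Fin n} (hij : i ≠ j) {x : Bool} (hx : x ≠ b j) :
    X.IsSquare (φ (Function.update b i false)) (φ (Function.update b i true))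
      (φ (Function.update (Function.update b j x) i true))
      (φ (Function.update (Function.update b j x) i false)) := by
  have h₁ : ∀ d : Fin n → Bool, X.skeleton.Adj (φ (Function.update d i false))
      (φ (Function.update d i true)) := fun d => by
    have := chart_adj hφ (Function.update d i false) i (x := true) (by simp)
    rwa [Function.update_idem] at this
  have h₂ : ∀ y, X.skeleton.Adj (φ (Function.update b i y))
      (φ (Function.update (Function.update b j x) i y)) := fun y => by
    have := chart_adj hφ (Function.update b i y) j (x := x)
      (by rwa [Function.update_of_ne hij.symm])
    rwa [Function.update_comm hij] at this
  have hne : ∀ (d e : Fin n → Bool) (y z : Bool), y ≠ z →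
      φ (Function.update d i y) ≠ φ (Function.update e i z) := fun d e y z hyz h => by
    have := congrFun (hφ.injective h) i
    rw [Function.update_self, Function.update_self] at this
    exact hyz this
  refine ⟨h₁ _, h₂ _, (h₁ _).symm, (h₂ _).symm, hne _ _ _ _ (by simp), hne _ _ _ _ (by simp), ?_⟩
  refine (hφ.mem_iff_face _ ?_).2
    ⟨fun k => if k = i ∨ k = j then Set.univ else {b k}, fun k => ?_, ?_⟩
  · rw [← hφ.range_eq]
    rintro _ (rfl | rfl | rfl | rfl) <;> exact ⟨_, rfl⟩
  · dsimp only
    split_ifs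
    · exact Set.univ_nonempty
    · exact Set.singleton_nonempty _
  · ext v
    constructor
    · have hmem : ∀ y z, φ (Function.update (Function.update b j z) i y) ∈
          φ '' Set.univ.pi fun k => if k = i ∨ k = j then Set.univ else {b k} := fun y z => by
        refine ⟨_, fun k _ => ?_, rfl⟩
        by_cases hk : k = i <;> by_cases hk' : k = j <;> simp [hk, hk']
      have hmem' : ∀ y, φ (Function.update b i y) ∈
          φ '' Set.univ.pi fun k => if k = i ∨ k = j then Set.univ else {b k} := fun y => by
        have := hmem y (b j)
        rwa [Function.update_eq_self] at this
      rintro (rfl | rfl | rfl | rfl)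
      exacts [hmem' _, hmem' _, hmem _ _, hmem _ _]
    · rintro ⟨d, hd, rfl⟩
      have hd' : ∀ k, k ≠ i → k ≠ j → d k = b k := fun k hk hk' => by
        simpa [hk, hk'] using hd k trivial
      have hcase : d = Function.update b i (d i) ∨
          d = Function.update (Function.update b j x) i (d i) := by
        by_cases hj : d j = b j
        · left
          funext k
          by_cases hk : k = i
          · rw [hk, Function.update_self]
          · rw [Function.update_of_ne hk]
            by_cases hk' : k = j
            · rw [hk', hj]
            · exact hd' k hk hk'
        · right
          funext k
          by_cases hk : k = i
          · rw [hk, Function.update_self]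
          · rw [Function.update_of_ne hk]
            by_cases hk' : k = j
            · subst hk'
              rw [Function.update_self]
              revert hj hx
              cases d k <;> cases b k <;> cases x <;> simp
            · rw [Function.update_of_ne hk']
              exact hd' k hk hk'
      rcases hcase with h | h <;> cases hdi : d i <;> rw [hdi] at h <;> rw [h] <;> simp

end Chart

theorem cube_induction {C : Set V} (hC : C ∈ X.cubes) {P : V → Prop}
    (h : ∀ a ∈ C, ∀ b ∈ C, X.skeleton.Adj a b → P a → P b) {v w : V} (hv : v ∈ C) (hw : w ∈ C)
    (hP : P v) : P w := by
  obtain ⟨n, φ, hφ⟩ := X.exists_chart C hC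
  rw [← hφ.range_eq] at hv hw
  obtain ⟨b, rfl⟩ := hv
  obtain ⟨c, rfl⟩ := hw
  refine Function.update_induction (P := fun d => P (φ d)) (fun a i x ha => ?_) hP c
  by_cases hx : x = a i
  · rwa [hx, Function.update_eq_self]
  · exact h _ (hφ.range_eq ▸ ⟨_, rfl⟩) _ (hφ.range_eq ▸ ⟨_, rfl⟩) (chart_adj hφ a i hx) ha

/-- The points having a vertex with `P` in their support form a clopen set: the support of a point
lies in a single cube, on which `P` is constant. -/
theorem vertex_induction [PreconnectedSpace X.Realization] {P : V → Prop}
    (h : ∀ a b, X.skeleton.Adj a b → P a → P b) {v : V} (hP : P v) (w : V) : P w := by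
  have hopen : ∀ Q : V → Prop, IsOpen {p : X.Realization | ∃ v, Q v ∧ 0 < p.1 v} := fun Q => by
    have : {p : X.Realization | ∃ v, Q v ∧ 0 < p.1 v} =
        ⋃ v ∈ {v | Q v}, {p : X.Realization | 0 < p.1 v} := by ext; simp
    rw [this]
    exact isOpen_biUnion fun v _ => isOpen_lt continuous_const (Realization.continuous_coord v)
  have hcompl : {p : X.Realization | ∃ v, P v ∧ 0 < p.1 v}ᶜ = {p | ∃ v, ¬ P v ∧ 0 < p.1 v} := by
    ext p
    constructor
    · intro hp
      obtain ⟨u, hu⟩ := p.exists_pos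
      exact ⟨u, fun hPu => hp ⟨u, hPu, hu⟩, hu⟩
    · rintro ⟨u, hu, hpu⟩ ⟨u', hu', hpu'⟩
      obtain ⟨C, hC, hp⟩ := p.exists_cube
      exact hu (cube_induction hC (fun a _ b _ => h a b) (hp u' hpu'.ne') (hp u hpu.ne') hu')
  have hclopen : IsClopen {p : X.Realization | ∃ v, P v ∧ 0 < p.1 v} :=
    ⟨⟨hcompl ▸ hopen _⟩, hopen _⟩
  have huniv := hclopen.eq_univ ⟨Realization.vertex X v, v, hP, by simp [Realization.vertex]⟩
  obtain ⟨u, hu, hw⟩ : Realization.vertex X w ∈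
      {p : X.Realization | ∃ v, P v ∧ 0 < p.1 v} := huniv ▸ trivial
  have : u = w := by
    by_contra hne
    simp [Realization.vertex, hne] at hw
  exact this ▸ hu

/-- An assignment of signs to the edges of `X` such that opposite edges of squares have the same
sign. -/
structure IsEdgeSign (X : CubeComplex V) (c : V → V → ℝ) : Prop where
  sign : ∀ v w, c v w = 1 ∨ c v w = -1
  symm : ∀ v w, c v w = c w v
  square : ∀ a b d e, X.IsSquare a b d e → c a b = c e d

/-! ### From signs on edges to a potential on vertices. -/

namespace IsEdgeSign

variable {c : V → V → ℝ}

theorem chart_eq (hc : X.IsEdgeSign c) {C : Set V} {n : ℕ} {φ : (Fin n → Bool) → V}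
    (hφ : IsCubeChart X.cubes C φ) (i : Fin n) (b d : Fin n → Bool) :
    c (φ (Function.update d i false)) (φ (Function.update d i true)) =
      c (φ (Function.update b i false)) (φ (Function.update b i true)) := by
  refine Function.update_induction (b := b) (P := fun d =>
    c (φ (Function.update d i false)) (φ (Function.update d i true)) =
      c (φ (Function.update b i false)) (φ (Function.update b i true)))
    (fun a j x ha => ?_) rfl d
  by_cases hij : i = j
  · subst hij
    rwa [Function.update_idem, Function.update_idem]
  · by_cases hx : x = a j
    · rwa [hx, Function.update_eq_self]
    · rw [← hc.square _ _ _ _ (chart_isSquare hφ a hij hx)]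
      exact ha

/-- All edges in direction `i` share a sign `η i`, so the product of `η i` over the coordinates of a
vertex that equal `true` is a potential. -/
theorem exists_potential_on_cube (hc : X.IsEdgeSign c) {C : Set V} (hC : C ∈ X.cubes) :
    ∃ f : V → ℝ, (∀ v ∈ C, f v = 1 ∨ f v = -1) ∧
      ∀ v ∈ C, ∀ w ∈ C, X.skeleton.Adj v w → f w = f v * c v w := by
  obtain ⟨n, φ, hφ⟩ := X.exists_chart C hC
  let η : Fin n → ℝ := fun i => c (φ (Function.update (fun _ => false) i false))
    (φ (Function.update (fun _ => false) i true))
  have hη : ∀ i, η i = 1 ∨ η i = -1 := fun i => hc.sign _ _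
  have hpar : ∀ i b, c (φ (Function.update b i false)) (φ (Function.update b i true)) = η i :=
    fun i b => hc.chart_eq hφ i _ b
  let F : Fin n → Bool → ℝ := fun i x => if x then η i else 1
  have hf : ∀ b, Function.extend φ (fun b => ∏ i, F i (b i)) 0 (φ b) = ∏ i, F i (b i) :=
    fun b => hφ.injective.extend_apply _ _ b
  refine ⟨Function.extend φ (fun b => ∏ i, F i (b i)) 0, fun v hv => ?_, fun v hv w hw hvw => ?_⟩
  · rw [← hφ.range_eq] at hv
    obtain ⟨b, rfl⟩ := hv
    rw [hf]
    refine Finset.prod_induction _ (fun r : ℝ => r = 1 ∨ r = -1) ?_ (Or.inl rfl) fun i _ => ?_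
    · rintro _ _ (rfl | rfl) (rfl | rfl) <;> simp
    · rcases hη i with h | h <;> cases b i <;> simp [F, h]
  · rw [← hφ.range_eq] at hv hw
    obtain ⟨b, rfl⟩ := hv
    obtain ⟨d, rfl⟩ := hw
    obtain ⟨i, rfl⟩ := exists_update_of_chart_adj hφ hvw
    rw [hf, hf, ← Finset.mul_prod_erase _ _ (Finset.mem_univ i),
      ← Finset.mul_prod_erase _ (fun i => F i (b i)) (Finset.mem_univ i), Function.update_self]
    have he : ∏ k ∈ Finset.univ.erase i, F k (Function.update b i (!b i) k) =
        ∏ k ∈ Finset.univ.erase i, F k (b k) := by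
      refine Finset.prod_congr rfl fun k hk => ?_
      rw [Function.update_of_ne (Finset.ne_of_mem_erase hk)]
    have hcη : c (φ b) (φ (Function.update b i (!b i))) = η i := by
      rw [← hpar i b]
      cases hb : b i
      · rw [show Function.update b i false = b by rw [← hb, Function.update_eq_self]]
        rfl
      · rw [show Function.update b i true = b by rw [← hb, Function.update_eq_self], hc.symm]
        rfl
    rw [he, hcη]
    have hηη : η i * η i = 1 := by rcases hη i with h | h <;> rw [h] <;> norm_num
    cases b i
    · simp only [F, Bool.not_false, if_true, Bool.false_eq_true, if_false]
      ring
    · simp only [F, Bool.not_true, if_true, Bool.false_eq_true, if_false]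
      linear_combination (-∏ k ∈ Finset.univ.erase i, F k (b k)) * hηη

theorem exists_signCocycle (hc : X.IsEdgeSign c) :
    ∃ σ, X.IsSignCocycle σ ∧ ∀ v w, X.skeleton.Adj v w → σ v w = c v w := by
  classical
  have hex : ∀ C : Set V, ∃ f : V → ℝ, C ∈ X.cubes → (∀ v ∈ C, f v = 1 ∨ f v = -1) ∧
      ∀ v ∈ C, ∀ w ∈ C, X.skeleton.Adj v w → f w = f v * c v w := fun C => by
    by_cases hC : C ∈ X.cubes
    · obtain ⟨f, hf⟩ := hc.exists_potential_on_cube hC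
      exact ⟨f, fun _ => hf⟩
    · exact ⟨0, fun h => absurd h hC⟩
  choose f hf using hex
  -- The value `1` for vertices without a common cube is arbitrary, since the cocycle conditions
  -- only concern pairs inside a cube.
  let σ : V → V → ℝ := fun v w =>
    if h : ∃ C, C ∈ X.cubes ∧ v ∈ C ∧ w ∈ C then f h.choose v * f h.choose w else 1
  have hσ : ∀ C ∈ X.cubes, ∀ v ∈ C, ∀ w ∈ C, σ v w = f C v * f C w := by
    intro C hC v hv w hw
    have h : ∃ C, C ∈ X.cubes ∧ v ∈ C ∧ w ∈ C := ⟨C, hC, hv, hw⟩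
    obtain ⟨hD, hvD, hwD⟩ := h.choose_spec
    have heq : σ v w = f h.choose v * f h.choose w := dif_pos h
    rw [heq]
    generalize h.choose = D at hD hvD hwD
    -- Independence of the chosen cube: the intersection is again a cube, hence edge-connected, and
    -- both potentials change by the same factor along its edges.
    have hCD := X.inter_mem C hC D hD ⟨v, hv, hvD⟩
    refine cube_induction hCD (P := fun u => f D v * f D u = f C v * f C u)
      (fun a ha b hb hab h' => ?_) ⟨hv, hvD⟩ ⟨hw, hwD⟩ ?_
    · rw [(hf D hD).2 a ha.2 b hb.2 hab, (hf C hC).2 a ha.1 b hb.1 hab]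
      linear_combination c a b * h'
    · rcases (hf D hD).1 v hvD with h₁ | h₁ <;> rcases (hf C hC).1 v hv with h₂ | h₂ <;>
        rw [h₁, h₂] <;> norm_num
  refine ⟨σ, ⟨fun C hC v hv w hw => ?_, fun C hC u hu v hv w hw => ?_⟩, fun v w hvw => ?_⟩
  · rw [hσ C hC v hv w hw]
    rcases (hf C hC).1 v hv with h₁ | h₁ <;> rcases (hf C hC).1 w hw with h₂ | h₂ <;>
      rw [h₁, h₂] <;> norm_num
  · rw [hσ C hC u hu v hv, hσ C hC v hv w hw, hσ C hC u hu w hw]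
    rcases (hf C hC).1 v hv with h₁ | h₁ <;> rw [h₁] <;> ring
  · rw [hσ _ hvw.2 v (by simp) w (by simp), (hf _ hvw.2).2 v (by simp) w (by simp) hvw]
    rcases (hf _ hvw.2).1 v (by simp) with h₁ | h₁ <;> rw [h₁] <;> ring

theorem exists_potential [SimplyConnectedSpace X.Realization] (hc : X.IsEdgeSign c) :
    ∃ f : V → ℝ, (∀ v, |f v| = 1) ∧ ∀ v w, X.skeleton.Adj v w → f w = f v * c v w := by
  obtain ⟨σ, hσ, hσc⟩ := hc.exists_signCocycle
  obtain ⟨f, hf, h⟩ := hσ.exists_potential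
  exact ⟨f, hf, fun v w hvw => by rw [← hσc v w hvw, h _ hvw.2 v (by simp) w (by simp)]⟩

end IsEdgeSign

end CubeComplex

/-! ### Squares, parallelism and labels. -/

namespace CubeComplex

variable {V : Type*} {X : CubeComplex V}

namespace IsSquare

variable {a b c d : V}

theorem reflect (h : X.IsSquare a b c d) : X.IsSquare a d c b := by
  obtain ⟨h₁, h₂, h₃, h₄, h₅, h₆, h₇⟩ := h
  refine ⟨h₄.symm, h₃.symm, h₂.symm, h₁.symm, h₅, h₆.symm, ?_⟩
  convert h₇ using 1
  ext v
  simp only [Set.mem_insert_iff, Set.mem_singleton_iff]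
  tauto

theorem rotate (h : X.IsSquare a b c d) : X.IsSquare b c d a := by
  obtain ⟨h₁, h₂, h₃, h₄, h₅, h₆, h₇⟩ := h
  refine ⟨h₂, h₃, h₄, h₁, h₆, h₅.symm, ?_⟩
  convert h₇ using 1
  ext v
  simp only [Set.mem_insert_iff, Set.mem_singleton_iff]
  tauto

theorem flip (h : X.IsSquare a b c d) : X.IsSquare b a d c := h.rotate.reflect

theorem map (h : X.IsSquare a b c d) (g : X.Aut) : X.IsSquare (g • a) (g • b) (g • c) (g • d) := by
  have hadj : ∀ {v w : V}, X.skeleton.Adj v w → X.skeleton.Adj (g • v) (g • w) := fun {v w} h =>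
    (g.mapEdge ⟨(v, w), h⟩).adj
  obtain ⟨h₁, h₂, h₃, h₄, h₅, h₆, h₇⟩ := h
  refine ⟨hadj h₁, hadj h₂, hadj h₃, hadj h₄, fun h => h₅ (MulAction.injective g h),
    fun h => h₆ (MulAction.injective g h), ?_⟩
  have := (g.image_mem_iff _).2 h₇
  simpa only [Set.image_insert_eq, Set.image_singleton] using this

end IsSquare

theorem OEdge.ext {e f : X.OEdge} (h₁ : e.fst = f.fst) (h₂ : e.snd = f.snd) : e = f :=
  SimpleGraph.Dart.ext _ _ (Prod.ext h₁ h₂)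

theorem parallel_of_isSquare {e f : X.OEdge} (h : X.IsSquare e.fst e.snd f.snd f.fst) :
    Parallel e f :=
  Relation.EqvGen.rel _ _ h

theorem Parallel.symm_symm {e f : X.OEdge} (h : Parallel e f) : Parallel e.symm f.symm := by
  induction h with
  | rel e f h => exact parallel_of_isSquare h.flip
  | refl e => exact Relation.EqvGen.refl _
  | symm e f _ ih => exact Relation.EqvGen.symm _ _ ih
  | trans e f k _ _ ih₁ ih₂ => exact Relation.EqvGen.trans _ _ _ ih₁ ih₂

theorem sameHyperplane_refl (e : X.OEdge) : SameHyperplane e e :=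
  Or.inl (Relation.EqvGen.refl _)

theorem sameHyperplane_symm_right {e f : X.OEdge} :
    SameHyperplane e f.symm ↔ SameHyperplane e f := by
  rw [SameHyperplane, SameHyperplane, SimpleGraph.Dart.symm_symm, or_comm]

theorem sameHyperplane_symm_left {e f : X.OEdge} :
    SameHyperplane e.symm f ↔ SameHyperplane e f := by
  have key : ∀ {e f : X.OEdge}, SameHyperplane e f → SameHyperplane e.symm f := by
    rintro e f (h | h)
    · exact Or.inr h.symm_symm
    · left
      have := h.symm_symm
      rwa [SimpleGraph.Dart.symm_symm] at this
  refine ⟨fun h => ?_, key⟩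
  have := key h
  rwa [SimpleGraph.Dart.symm_symm] at this

theorem SameHyperplane.of_isSquare {e f k : X.OEdge} (h : SameHyperplane e f)
    (hfk : X.IsSquare f.fst f.snd k.snd k.fst) : SameHyperplane e k :=
  h.imp (fun h => Relation.EqvGen.trans _ _ _ h (parallel_of_isSquare hfk))
    fun h => Relation.EqvGen.trans _ _ _ h (parallel_of_isSquare hfk).symm_symm

/-! ### Labels of squares -/

variable {S : Type*}

/-- Some square of `X` has edges with labels `s` and `t` emanating from one of its vertices. -/
def SquareLabels (ℓ : X.OEdge → S) (s t : S) : Prop :=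
  ∃ e f : X.OEdge, e.fst = f.fst ∧ (∃ w, X.IsSquare e.fst e.snd w f.snd) ∧ ℓ e = s ∧ ℓ f = t

theorem SquareLabels.symm {ℓ : X.OEdge → S} {s t : S} (h : SquareLabels ℓ s t) :
    SquareLabels ℓ t s := by
  obtain ⟨e, f, hef, ⟨w, hw⟩, rfl, rfl⟩ := h
  exact ⟨f, e, hef.symm, ⟨w, hef ▸ hw.reflect⟩, rfl, rfl⟩

namespace IsAdmissible

variable [InvolutiveInv S] {ℓ : X.OEdge → S}

theorem label_eq_of_isSquare (hℓ : IsAdmissible ℓ) {e f : X.OEdge}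
    (h : X.IsSquare e.fst e.snd f.snd f.fst) : ℓ e = ℓ f :=
  hℓ.parallel _ _ (parallel_of_isSquare h)

theorem squareLabels_inv_left (hℓ : IsAdmissible ℓ) {s t : S} (h : SquareLabels ℓ s t) :
    SquareLabels ℓ s⁻¹ t := by
  obtain ⟨e, f, hef, ⟨w, hw⟩, rfl, rfl⟩ := h
  refine ⟨e.symm, ⟨(e.snd, w), hw.2.1⟩, rfl, ⟨f.snd, hw.flip⟩, hℓ.symm e, ?_⟩
  refine (hℓ.label_eq_of_isSquare ?_).symm
  have := hw.reflect
  rw [hef] at this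
  exact this

theorem squareLabels_inv_right (hℓ : IsAdmissible ℓ) {s t : S} (h : SquareLabels ℓ s t) :
    SquareLabels ℓ s t⁻¹ :=
  (hℓ.squareLabels_inv_left h.symm).symm

theorem not_squareLabels_self (hℓ : IsAdmissible ℓ) (s : S) : ¬ SquareLabels ℓ s s := by
  rintro ⟨e, f, hef, ⟨w, hw⟩, he, hf⟩
  have := hℓ.injective e f hef (he.trans hf.symm)
  subst this
  exact hw.2.2.2.2.2.1 rfl

/-- Crossing hyperplanes meet in an actual square, whose labels agree with the given ones up to
inversion, and inversion is harmless by passing to another corner. Conversely, if the two edges at a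
corner of a square crossed the same hyperplane, some label would form a square corner with itself,
against injectivity at a vertex. -/
theorem labelsCommute_iff (hℓ : IsAdmissible ℓ) {s t : S} :
    LabelsCommute ℓ s t ↔ SquareLabels ℓ s t := by
  constructor
  · rintro ⟨e, f, -, ⟨-, -, e', f', hef, hsq, he, hf⟩, rfl, rfl⟩
    have h : SquareLabels ℓ (ℓ e') (ℓ f') := ⟨e', f', hef, hsq, rfl, rfl⟩
    have key : ∀ {e e' : X.OEdge}, SameHyperplane e e' → ℓ e' = ℓ e ∨ ℓ e' = (ℓ e)⁻¹ := by
      rintro e e' (h | h)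
      · exact Or.inl (hℓ.parallel _ _ h).symm
      · right
        rw [hℓ.parallel _ _ h, hℓ.symm, inv_inv]
    have h₁ : SquareLabels ℓ (ℓ e) (ℓ f') := by
      rcases key he with h' | h' <;> rw [h'] at h
      · exact h
      · simpa using hℓ.squareLabels_inv_left h
    rcases key hf with h' | h' <;> rw [h'] at h₁
    · exact h₁
    · simpa using hℓ.squareLabels_inv_right h₁
  · rintro ⟨e, f, hef, ⟨w, hw⟩, rfl, rfl⟩
    have hsq : SquareLabels ℓ (ℓ e) (ℓ f) := ⟨e, f, hef, ⟨w, hw⟩, rfl, rfl⟩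
    refine ⟨e, f, hef, ⟨⟨e.fst, ⟨?_, ?_⟩, ?_⟩, ?_, e, f, hef, ⟨w, hw⟩, sameHyperplane_refl e,
      sameHyperplane_refl f⟩, rfl, rfl⟩
    · exact Sym2.mem_mk_left _ _
    · rw [hef]
      exact Sym2.mem_mk_left _ _
    · rintro v ⟨hv, hv'⟩
      rcases Sym2.mem_iff.1 hv with h | h
      · exact h
      · rcases Sym2.mem_iff.1 hv' with h' | h'
        · exact h'.trans hef.symm
        · exact absurd (h.symm.trans h') hw.2.2.2.2.2.1
    · rintro (h | h)
      · rw [hℓ.parallel _ _ h] at hsq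
        exact hℓ.not_squareLabels_self _ hsq
      · rw [hℓ.parallel _ _ h, hℓ.symm] at hsq
        have := hℓ.squareLabels_inv_left hsq
        rw [inv_inv] at this
        exact hℓ.not_squareLabels_self _ this

/-- The fourth vertex of a square is fixed if the other three are. -/
theorem smul_eq_of_isSquare (hℓ : IsAdmissible ℓ) {g : X.Aut} {a b c d : V}
    (h : X.IsSquare a b c d) (ha : g • a = a) (hb : g • b = b) (hd : g • d = d) : g • c = c := by
  have h' := h.map g
  rw [ha, hb, hd] at h'
  let e₁ : X.OEdge := ⟨(b, c), h.2.1⟩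
  let e₂ : X.OEdge := ⟨(b, g • c), h'.2.1⟩
  let f : X.OEdge := ⟨(a, d), h.2.2.2.1.symm⟩
  have h₁ : ℓ f = ℓ e₁ := hℓ.label_eq_of_isSquare h.reflect
  have h₂ : ℓ f = ℓ e₂ := hℓ.label_eq_of_isSquare h'.reflect
  have := hℓ.injective e₁ e₂ rfl (h₁.symm.trans h₂)
  exact (congrArg (fun e : X.OEdge => e.snd) this).symm

end IsAdmissible

/-- Every vertex is the initial vertex of an edge with any label that occurs, and two edges with a
common initial vertex whose labels occur at a corner of some square are edges of a square. -/
structure IsHomogeneous (ℓ : X.OEdge → S) : Prop where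
  exists_edge : ∀ (e : X.OEdge) (v : V), ∃ f : X.OEdge, f.fst = v ∧ ℓ f = ℓ e
  exists_square : ∀ e f : X.OEdge, e.fst = f.fst → SquareLabels ℓ (ℓ e) (ℓ f) →
    ∃ w, X.IsSquare e.fst e.snd w f.snd

/-- A group element carrying one vertex to another preserves labels, and edges at a vertex are
determined by their labels, so local pictures are transported exactly. -/
theorem IsAdmissible.isHomogeneous [InvolutiveInv S] {ℓ : X.OEdge → S} (hadm : IsAdmissible ℓ)
    {Γ : Type*} [Group Γ] (ρ : Γ →* X.Aut)
    (hℓ : ∀ (γ : Γ) (e : X.OEdge), ℓ ((ρ γ).mapEdge e) = ℓ e)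
    (htrans : ∀ v w : V, ∃ γ : Γ, ρ γ • v = w) : IsHomogeneous ℓ where
  exists_edge e v := by
    obtain ⟨γ, hγ⟩ := htrans e.fst v
    exact ⟨(ρ γ).mapEdge e, hγ, hℓ γ e⟩
  exists_square := by
    rintro e f hef ⟨e', f', hef', ⟨w, hw⟩, he, hf⟩
    obtain ⟨γ, hγ⟩ := htrans e'.fst e.fst
    have h₁ : (ρ γ).mapEdge e' = e := hadm.injective _ _ hγ ((hℓ γ e').trans he)
    have h₂ : (ρ γ).mapEdge f' = f := by
      refine hadm.injective _ _ ?_ ((hℓ γ f').trans hf)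
      rw [← hef, ← hγ, hef']
      rfl
    rw [← h₁, ← h₂]
    exact ⟨_, hw.map (ρ γ)⟩

/-! ### Automorphisms that fix the carrier of a hyperplane -/

/-- `g` fixes `w` and its neighbours in the carrier of the hyperplane crossed by the edge with
initial vertex `w` and label `s`. -/
def FixesCarrierAt (ℓ : X.OEdge → S) (s : S) (g : X.Aut) (w : V) : Prop :=
  g • w = w ∧ ∀ f : X.OEdge, f.fst = w → (ℓ f = s ∨ SquareLabels ℓ s (ℓ f)) → g • f.snd = f.snd

variable [InvolutiveInv S] {ℓ : X.OEdge → S}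

theorem FixesCarrierAt.snd (hadm : IsAdmissible ℓ) (hhom : IsHomogeneous ℓ) {s : S}
    (hs : ∀ t r : S, t ≠ r → SquareLabels ℓ s t → SquareLabels ℓ s r →
      t = r⁻¹ ∨ SquareLabels ℓ t r)
    {g : X.Aut} {f : X.OEdge} (hf : SquareLabels ℓ s (ℓ f)) (hg : FixesCarrierAt ℓ s g f.fst) :
    FixesCarrierAt ℓ s g f.snd := by
  have hfix : g • f.snd = f.snd := hg.2 f rfl (Or.inr hf)
  -- A neighbour of `f.snd` is fixed if it is the fourth vertex of a square on `f` and an edge `k`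
  -- with fixed endpoints.
  have transport : ∀ k : X.OEdge, k.fst = f.fst → g • k.snd = k.snd →
      SquareLabels ℓ (ℓ f) (ℓ k) → ∀ f' : X.OEdge, f'.fst = f.snd → ℓ f' = ℓ k →
        g • f'.snd = f'.snd := by
    intro k hk hgk hfk f' hf' hlf'
    obtain ⟨x, hx⟩ := hhom.exists_square f k hk.symm hfk
    have hgx : g • x = x := hadm.smul_eq_of_isSquare hx hg.1 hfix hgk
    let k' : X.OEdge := ⟨(f.snd, x), hx.2.1⟩
    have hkk' : ℓ k = ℓ k' := hadm.label_eq_of_isSquare (f := k') (by rw [hk]; exact hx.reflect)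
    rw [hadm.injective f' k' hf' (hlf'.trans hkk')]
    exact hgx
  have hlabel : ∀ f' : X.OEdge, f'.fst = f.snd → ℓ f' = s → g • f'.snd = f'.snd := by
    intro f' hf' hlf'
    obtain ⟨k, hk, hlk⟩ := hhom.exists_edge f' f.fst
    exact transport k hk (hg.2 k hk (Or.inl (hlk.trans hlf')))
      (by rw [hlk, hlf']; exact hf.symm) f' hf' hlk.symm
  have hback : ∀ f' : X.OEdge, f'.fst = f.snd → SquareLabels ℓ s (ℓ f') → ℓ f' ≠ ℓ f →
      g • f'.snd = f'.snd := by
    intro f' hf' hsf' hne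
    rcases hs _ _ hne.symm hf hsf' with h | h
    · have : f' = f.symm := hadm.injective _ _ hf' (by rw [hadm.symm, h, inv_inv])
      rw [this]
      exact hg.1
    · obtain ⟨k, hk, hlk⟩ := hhom.exists_edge f' f.fst
      exact transport k hk (hg.2 k hk (Or.inr (hlk ▸ hsf'))) (hlk ▸ h) f' hf' hlk.symm
  refine ⟨hfix, fun f' hf' h => ?_⟩
  rcases h with h | h
  · exact hlabel f' hf' h
  by_cases hne : ℓ f' = ℓ f
  swap
  · exact hback f' hf' h hne
  -- Remaining case: `f'` continues `f` with the same label, where the commutation hypothesis says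
  -- nothing. Since `g` fixes the edge `k` labelled `s`, it maps the square on `k` and `f'` to a
  -- square on `k`, so the label of the image of `f'` again commutes with `s`.
  obtain ⟨k₀, -, -, -, hk₀, -⟩ := id h
  obtain ⟨k, hk, hlk⟩ := hhom.exists_edge k₀ f.snd
  rw [hk₀] at hlk
  have hgk := hlabel k hk hlk
  obtain ⟨y, hy⟩ := hhom.exists_square k f' (hk.trans hf'.symm) (hlk ▸ h)
  have hy' := hy.map g
  have hk_fst : g • k.fst = k.fst := by rw [hk, hfix]
  rw [hk_fst, hgk] at hy'
  have hgf' : (g.mapEdge f').fst = f.snd := by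
    change g • f'.fst = f.snd
    rw [hf', hfix]
  have hsq : SquareLabels ℓ s (ℓ (g.mapEdge f')) :=
    ⟨k, g.mapEdge f', hk.trans hgf'.symm, ⟨_, hy'⟩, hlk, rfl⟩
  by_cases hq : ℓ (g.mapEdge f') = ℓ f
  · have := hadm.injective (g.mapEdge f') f' (hgf'.trans hf'.symm) (hq.trans hne.symm)
    exact congrArg (fun e : X.OEdge => e.snd) this
  -- Otherwise the image of `f'` ends at a neighbour already known to be fixed, and cancelling `g`
  -- shows that the end of `f'` is that neighbour.
  · exact MulAction.injective g (hback _ hgf' hsq hq)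

theorem FixesCarrierAt.parallel (hadm : IsAdmissible ℓ) (hhom : IsHomogeneous ℓ) {s : S}
    (hs : ∀ t r : S, t ≠ r → SquareLabels ℓ s t → SquareLabels ℓ s r →
      t = r⁻¹ ∨ SquareLabels ℓ t r)
    {g : X.Aut} {e f : X.OEdge} (hef : Parallel e f) (he : ℓ e = s) :
    FixesCarrierAt ℓ s g e.fst ↔ FixesCarrierAt ℓ s g f.fst := by
  have key : ∀ {e f : X.OEdge}, X.IsSquare e.fst e.snd f.snd f.fst → ℓ e = s →
      FixesCarrierAt ℓ s g e.fst → FixesCarrierAt ℓ s g f.fst := by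
    intro e f h he hg
    let k : X.OEdge := ⟨(e.fst, f.fst), h.2.2.2.1.symm⟩
    exact FixesCarrierAt.snd hadm hhom hs (f := k) ⟨e, k, rfl, ⟨_, h⟩, he, rfl⟩ hg
  induction hef with
  | rel e f h =>
    exact ⟨key h he, key h.reflect.rotate
      ((hadm.label_eq_of_isSquare h).symm.trans he)⟩
  | refl e => exact Iff.rfl
  | symm e f h ih => exact (ih ((hadm.parallel _ _ h).trans he)).symm
  | trans e f k h _ ih₁ ih₂ => exact (ih₁ he).trans (ih₂ ((hadm.parallel _ _ h).symm.trans he))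

theorem FixesCarrierAt.smul_eq_of_sameHyperplane (hadm : IsAdmissible ℓ) (hhom : IsHomogeneous ℓ)
    {e : X.OEdge} (hs : ∀ t r : S, t ≠ r → SquareLabels ℓ (ℓ e) t → SquareLabels ℓ (ℓ e) r →
      t = r⁻¹ ∨ SquareLabels ℓ t r)
    {g : X.Aut} (hg : FixesCarrierAt ℓ (ℓ e) g e.fst) {f : X.OEdge} (hef : SameHyperplane e f) :
    g • f.fst = f.fst ∧ g • f.snd = f.snd := by
  have key : ∀ {f : X.OEdge}, Parallel e f → g • f.fst = f.fst ∧ g • f.snd = f.snd := by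
    intro f h
    have := (FixesCarrierAt.parallel hadm hhom hs h rfl).1 hg
    exact ⟨this.1, this.2 f rfl (Or.inl (hadm.parallel _ _ h).symm)⟩
  rcases hef with h | h
  · exact key h
  · exact (key h).symm

end CubeComplex

/-! ### Cutting an automorphism along a hyperplane. -/

namespace CubeComplex

variable {V : Type*} {X : CubeComplex V}

theorem Aut.ext {g h : X.Aut} (H : ∀ v : V, g • v = h • v) : g = h :=
  Subtype.ext (Equiv.ext H)

/-- An automorphism that preserves the set of vertices satisfying `p`, and that fixes every cube
meeting both this set and its complement, can be replaced by the identity on the complement. -/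
theorem Aut.exists_piecewise (g : X.Aut) (p : V → Prop) (hp : ∀ v, p (g • v) ↔ p v)
    (hcube : ∀ C ∈ X.cubes, (∀ v ∈ C, p v) ∨ (∀ v ∈ C, ¬ p v) ∨ ∀ v ∈ C, g • v = v) :
    ∃ g' : X.Aut, (∀ v, p v → g' • v = g • v) ∧ ∀ v, ¬ p v → g' • v = v := by
  classical
  have key : ∀ k : X.Aut, (∀ C ∈ X.cubes, (∀ v ∈ C, p v) ∨ (∀ v ∈ C, ¬ p v) ∨
      ∀ v ∈ C, k • v = v) → ∀ C ∈ X.cubes, (fun v => if p v then k • v else v) '' C ∈ X.cubes := by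
    intro k hk C hC
    have hcongr : ∀ F : V → V, (∀ v ∈ C, (if p v then k • v else v) = F v) →
        F '' C ∈ X.cubes → (fun v => if p v then k • v else v) '' C ∈ X.cubes := by
      intro F hF h
      rwa [Set.image_congr hF]
    rcases hk C hC with h | h | h
    · exact hcongr (fun v => k • v) (fun v hv => if_pos (h v hv)) ((k.image_mem_iff C).2 hC)
    · exact hcongr id (fun v hv => if_neg (h v hv)) (by rwa [Set.image_id])
    · exact hcongr id (fun v hv => by simp [h v hv]) (by rwa [Set.image_id])
  have hp' : ∀ v, p (g⁻¹ • v) ↔ p v := fun v => by rw [← hp, smul_inv_smul]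
  have hcube' : ∀ C ∈ X.cubes, (∀ v ∈ C, p v) ∨ (∀ v ∈ C, ¬ p v) ∨ ∀ v ∈ C, g⁻¹ • v = v :=
    fun C hC => (hcube C hC).imp_right (Or.imp_right fun h v hv => by
      rw [inv_smul_eq_iff, h v hv])
  let σ : Equiv.Perm V :=
    { toFun := fun v => if p v then g • v else v
      invFun := fun v => if p v then g⁻¹ • v else v
      left_inv := fun v => by
        by_cases hv : p v
        · simp [hv, hp]
        · simp [hv]
      right_inv := fun v => by
        by_cases hv : p v
        · simp [hv, hp']
        · simp [hv] }
  have hσ : σ ∈ X.autGroup := by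
    intro C
    refine ⟨fun h => ?_, key g hcube C⟩
    have := key g⁻¹ hcube' _ h
    rw [Set.image_image] at this
    convert this using 1
    refine (Set.image_id C).symm.trans (Set.image_congr fun v _ => ?_)
    exact (σ.symm_apply_apply v).symm
  exact ⟨⟨σ, hσ⟩, fun v hv => if_pos hv, fun v hv => if_neg hv⟩

open Classical in
/-- The sign `-1` on the edges that cross the same hyperplane as `e`. -/
noncomputable def hyperplaneSign (e : X.OEdge) (v w : V) : ℝ :=
  if ∃ h : X.skeleton.Adj v w, SameHyperplane e ⟨(v, w), h⟩ then -1 else 1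

theorem hyperplaneSign_of_sameHyperplane {e f : X.OEdge} (h : SameHyperplane e f) :
    hyperplaneSign e f.fst f.snd = -1 :=
  if_pos ⟨f.adj, h⟩

theorem hyperplaneSign_of_not_sameHyperplane {e f : X.OEdge} (h : ¬ SameHyperplane e f) :
    hyperplaneSign e f.fst f.snd = 1 :=
  if_neg fun ⟨_, h'⟩ => h h'

theorem isEdgeSign_hyperplaneSign (e : X.OEdge) : X.IsEdgeSign (hyperplaneSign e) where
  sign v w := by
    unfold hyperplaneSign
    split_ifs <;> simp
  symm v w := by
    unfold hyperplaneSign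
    congr 1
    refine propext ⟨fun ⟨h, h'⟩ => ⟨h.symm, ?_⟩, fun ⟨h, h'⟩ => ⟨h.symm, ?_⟩⟩ <;>
      exact sameHyperplane_symm_right.2 h'
  square a b c d h := by
    unfold hyperplaneSign
    congr 1
    exact propext ⟨fun ⟨_, h'⟩ => ⟨h.2.2.1.symm, h'.of_isSquare h⟩,
      fun ⟨_, h'⟩ => ⟨h.1, h'.of_isSquare h.reflect.rotate⟩⟩

/-- An automorphism that fixes both endpoints of every edge crossing a given hyperplane is a
product of two automorphisms, each of which fixes one of its halfspaces pointwise. -/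
theorem mem_autPlus_of_fixes_hyperplane [SimplyConnectedSpace X.Realization] (e : X.OEdge)
    (g : X.Aut) (hg : ∀ f : X.OEdge, SameHyperplane e f → g • f.fst = f.fst ∧ g • f.snd = f.snd) :
    g ∈ X.AutPlus := by
  have hc := isEdgeSign_hyperplaneSign e
  obtain ⟨F, hF, hFc⟩ := hc.exists_potential
  have hF0 : ∀ v, F v ≠ 0 := fun v h => by simpa [h] using hF v
  -- `g` preserves the set of crossing edges: if the image of `f` crosses, its endpoints are fixed,
  -- so `f` equals its image.
  have hcg : ∀ f : X.OEdge, hyperplaneSign e (g • f.fst) (g • f.snd) =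
      hyperplaneSign e f.fst f.snd := by
    intro f
    by_cases h : SameHyperplane e f
    · rw [(hg f h).1, (hg f h).2]
    · rw [hyperplaneSign_of_not_sameHyperplane h]
      refine hyperplaneSign_of_not_sameHyperplane (f := g.mapEdge f) fun h' => h ?_
      have h₁ : g • f.fst = f.fst := MulAction.injective g (hg _ h').1
      have h₂ : g • f.snd = f.snd := MulAction.injective g (hg _ h').2
      rwa [OEdge.ext (e := g.mapEdge f) (f := f) h₁ h₂] at h'
  have hFg : ∀ v, F (g • v) = F v := by
    refine vertex_induction (X := X) (v := e.fst) (fun a b hab h => ?_) ?_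
    · let f : X.OEdge := ⟨(a, b), hab⟩
      calc F (g • b) = F (g • a) * hyperplaneSign e (g • a) (g • b) :=
            hFc _ _ (g.mapEdge f).adj
        _ = F a * hyperplaneSign e a b := congrArg₂ _ h (hcg f)
        _ = F b := (hFc _ _ hab).symm
    · rw [(hg e (sameHyperplane_refl e)).1]
  have hcube : ∀ C ∈ X.cubes, (∀ v ∈ C, F v = F e.snd) ∨ (∀ v ∈ C, ¬ F v = F e.snd) ∨
      ∀ v ∈ C, g • v = v := by
    intro C hC
    by_cases hcross : ∃ a ∈ C, ∃ b ∈ C, ∃ h : X.skeleton.Adj a b, SameHyperplane e ⟨(a, b), h⟩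
    · right; right
      obtain ⟨a, ha, b, hb, hab, h⟩ := hcross
      obtain ⟨n, φ, hφ⟩ := X.exists_chart C hC
      rw [← hφ.range_eq] at ha hb ⊢
      obtain ⟨a, rfl⟩ := ha
      obtain ⟨b, rfl⟩ := hb
      obtain ⟨i, rfl⟩ := exists_update_of_chart_adj hφ hab
      have hsign : hyperplaneSign e (φ (Function.update a i false))
          (φ (Function.update a i true)) = -1 := by
        have h' : hyperplaneSign e (φ a) (φ (Function.update a i !a i)) = -1 :=
          hyperplaneSign_of_sameHyperplane h
        cases ha : a i
        · rw [show Function.update a i false = a by rw [← ha, Function.update_eq_self]]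
          rwa [ha] at h'
        · rw [show Function.update a i true = a by rw [← ha, Function.update_eq_self], hc.symm]
          rwa [ha] at h'
      rintro _ ⟨d, rfl⟩
      -- All edges of the cube in direction `i` cross the hyperplane, and every vertex of the cube
      -- is an endpoint of one of them.
      rw [hc.chart_eq hφ i d a] at hsign
      have hadj : ∃ h, SameHyperplane e
          ⟨(φ (Function.update d i false), φ (Function.update d i true)), h⟩ := by
        by_contra hn
        rw [hyperplaneSign, if_neg hn] at hsign
        norm_num at hsign
      obtain ⟨hadj, h'⟩ := hadj
      have hfix := hg _ h'
      have hd : d = Function.update d i (d i) := (Function.update_eq_self i d).symm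
      cases hdi : d i <;> rw [hdi] at hd <;> rw [hd]
      exacts [hfix.1, hfix.2]
    · have hconst : ∀ v ∈ C, ∀ w ∈ C, F w = F v := fun v hv w hw => by
        refine cube_induction hC (P := fun w => F w = F v) (fun a ha b hb hab h => ?_) hv hw rfl
        rw [← h, hFc _ _ hab]
        have : hyperplaneSign e a b = 1 :=
          if_neg fun ⟨hab, h'⟩ => hcross ⟨a, ha, b, hb, hab, h'⟩
        rw [this, mul_one]
      by_cases h : ∃ v ∈ C, F v = F e.snd
      · obtain ⟨v, hv, hve⟩ := h
        exact Or.inl fun w hw => (hconst v hv w hw).trans hve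
      · exact Or.inr (Or.inl fun v hv hve => h ⟨v, hv, hve⟩)
  -- Stated for a general `f` so as to serve both `e` and `e.symm`, that is, both halfspaces.
  have hhalf : ∀ f : X.OEdge, (∀ k, SameHyperplane e k → SameHyperplane f k) →
      ∀ v ∈ halfspace f, F v = F f.snd := by
    intro f hf v hv
    induction hv with
    | refl => rfl
    | tail _ h ih =>
      obtain ⟨k, rfl, rfl, hk⟩ := h
      rw [hFc _ _ k.adj, ih, hyperplaneSign_of_not_sameHyperplane fun h => hk (hf k h), mul_one]
  have hne : F e.fst ≠ F e.snd := by
    rw [hFc _ _ e.adj, hyperplaneSign_of_sameHyperplane (sameHyperplane_refl e)]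
    intro h
    exact hF0 e.fst (by linarith)
  obtain ⟨g₁, h₁, h₁'⟩ := g.exists_piecewise (fun v => F v = F e.snd) (fun v => by rw [hFg]) hcube
  obtain ⟨g₂, h₂, h₂'⟩ := g.exists_piecewise (fun v => ¬ F v = F e.snd) (fun v => by rw [hFg])
    fun C hC => by
      rcases hcube C hC with h | h | h
      · exact Or.inr (Or.inl fun v hv hn => hn (h v hv))
      · exact Or.inl h
      · exact Or.inr (Or.inr h)
  have hgg : g = g₁ * g₂ := by
    refine Aut.ext fun v => ?_
    rw [mul_smul]
    by_cases hv : F v = F e.snd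
    · rw [h₂' v (not_not.2 hv), h₁ v hv]
    · rw [h₂ v hv, h₁' _ (by rwa [hFg])]
  rw [hgg]
  refine mul_mem (Subgroup.subset_closure ⟨halfspace e.symm, ⟨_, rfl⟩, fun v hv => h₁' v ?_⟩)
    (Subgroup.subset_closure ⟨halfspace e, ⟨_, rfl⟩, fun v hv => h₂' v (not_not.2 ?_)⟩)
  · rw [hhalf e.symm (fun k hk => sameHyperplane_symm_left.2 hk) v hv]
    exact hne
  · exact hhalf e (fun k hk => hk) v hv

end CubeComplex

/-! ### The compact-open topology on the automorphism group. -/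

namespace CubeComplex

open Filter Topology

variable {V : Type*} {X : CubeComplex V}

theorem finite_of_mem_cubes {C : Set V} (hC : C ∈ X.cubes) : C.Finite := by
  obtain ⟨n, φ, hφ⟩ := X.exists_chart C hC
  rw [← hφ.range_eq]
  exact Set.finite_range φ

theorem LocallyFinite.finite_star (hfin : X.LocallyFinite) (v : V) :
    (⋃ C ∈ {C | C ∈ X.cubes ∧ v ∈ C}, C).Finite :=
  (hfin v).biUnion fun _ hC => finite_of_mem_cubes hC.1

theorem LocallyFinite.finite_neighbors (hfin : X.LocallyFinite) (v : V) :
    {w | X.skeleton.Adj v w}.Finite :=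
  (hfin.finite_star v).subset fun w hw => Set.mem_biUnion (x := {v, w}) ⟨hw.2, by simp⟩ (by simp)

namespace Aut

/-- This is a subbasic set of the compact-open topology: the compact set is a vertex, and the open
set is the open star of `w`, which contains no other vertex. -/
theorem isOpen_setOf_smul_eq (v w : V) : IsOpen {g : X.Aut | g • v = w} := by
  have : {g : X.Aut | g • v = w} = realize ⁻¹'
      {F | Set.MapsTo F {Realization.vertex X v} {p : X.Realization | 0 < p.1 w}} := by
    ext g
    simp only [Set.mem_ofPred_eq, Set.mem_preimage, Set.mapsTo_singleton]
    change _ ↔ 0 < (Realization.vertex X v).1 (g⁻¹ • w)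
    rw [eq_comm, ← inv_smul_eq_iff]
    by_cases h : g⁻¹ • w = v <;> simp [Realization.vertex, h]
  rw [this]
  exact (ContinuousMap.isOpen_setOfPred_mapsTo isCompact_singleton
    (isOpen_lt continuous_const (Realization.continuous_coord w))).preimage continuous_induced_dom

instance : T2Space X.Aut where
  t2 g h hgh := by
    obtain ⟨v, hv⟩ : ∃ v : V, g • v ≠ h • v := by
      by_contra! H
      exact hgh (Aut.ext H)
    refine ⟨_, _, isOpen_setOf_smul_eq v (g • v), isOpen_setOf_smul_eq v (h • v), rfl, rfl, ?_⟩
    exact Set.disjoint_left.2 fun k hk hk' => hv (hk.symm.trans hk')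

/-- A compact set is covered by finitely many open stars, so all its points are supported on one
finite vertex set `F`. Automorphisms agreeing on `F` agree on the compact set. -/
theorem le_nhds_of_eventually_smul_eq (hfin : X.LocallyFinite) {l : Filter X.Aut} {g : X.Aut}
    (h : ∀ v : V, ∀ᶠ k in l, k • v = g • v) : l ≤ 𝓝 g := by
  rw [nhds_induced, ← map_le_iff_le_comap]
  refine ContinuousMap.tendsto_nhds_compactOpen.2 fun K hK U _ hKU => ?_
  obtain ⟨t, ht⟩ := hK.elim_finite_subcover (fun v => {p : X.Realization | 0 < p.1 v})
    (fun v => isOpen_lt continuous_const (Realization.continuous_coord v))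
    fun p _ => Set.mem_iUnion.2 p.exists_pos
  let F : Set V := ⋃ v ∈ t, ⋃ C ∈ {C | C ∈ X.cubes ∧ v ∈ C}, C
  have hF : F.Finite := t.finite_toSet.biUnion fun v _ => hfin.finite_star v
  filter_upwards [(eventually_all_finite hF).2 fun v _ => h v] with k hk p hp
  have hpF : ∀ w, p.1 w ≠ 0 → w ∈ F := by
    intro w hw
    obtain ⟨v, hv, hpv⟩ : ∃ v ∈ t, 0 < p.1 v := by simpa using ht hp
    obtain ⟨C, hC, hpC⟩ := p.exists_cube
    exact Set.mem_biUnion hv (Set.mem_biUnion (x := C) ⟨hC, hpC v hpv.ne'⟩ (hpC w hw))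
  have : k.realize p = g.realize p := by
    refine Subtype.ext (funext fun v => ?_)
    change p.1 (k⁻¹ • v) = p.1 (g⁻¹ • v)
    by_cases hkv : k⁻¹ • v ∈ F
    · have := hk _ hkv
      rw [smul_inv_smul] at this
      rw [← inv_smul_eq_iff.2 this]
    by_cases hgv : g⁻¹ • v ∈ F
    · have := hk _ hgv
      rw [smul_inv_smul] at this
      rw [← inv_smul_eq_iff.2 this.symm]
    rw [not_imp_comm.1 (hpF _) hkv, not_imp_comm.1 (hpF _) hgv]
  rw [this]
  exact hKU hp

/-- Finiteness spreads along edges: images of a neighbour of `a` are neighbours of the finitely many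
images of `a`. -/
theorem finite_orbit (hfin : X.LocallyFinite) [PreconnectedSpace X.Realization] (A : Set X.Aut)
    {v : V} (hv : ((fun g : X.Aut => g • v) '' A).Finite) (w : V) :
    ((fun g : X.Aut => g • w) '' A).Finite := by
  refine vertex_induction (X := X) (P := fun w => ((fun g : X.Aut => g • w) '' A).Finite)
    (fun a b hab ha => ?_) hv w
  refine (ha.biUnion fun u _ => hfin.finite_neighbors u).subset ?_
  rintro _ ⟨g, hg, rfl⟩
  exact Set.mem_biUnion (Set.mem_image_of_mem (fun g : X.Aut => g • a) hg)
    (g.mapEdge ⟨(a, b), hab⟩).adj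

/-- In a locally finite connected cube complex, a set of automorphisms that is cut out by
prescribing the images of the elements of a nonempty set of vertices is compact. -/
theorem isCompact_setOf_eqOn (hfin : X.LocallyFinite) [PreconnectedSpace X.Realization]
    {K : Set V} (hK : K.Nonempty) (g₀ : X.Aut) :
    IsCompact {g : X.Aut | ∀ v ∈ K, g • v = g₀ • v} := by
  set B : Set X.Aut := {g : X.Aut | ∀ v ∈ K, g • v = g₀ • v} with hB
  obtain ⟨v₀, hv₀⟩ := hK
  have horb : ∀ v : V, ((fun g : X.Aut => g • v) '' B).Finite :=
    finite_orbit hfin B (v := v₀) ((Set.finite_singleton (g₀ • v₀)).subset (by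
      rintro _ ⟨g, hg, rfl⟩
      exact hg v₀ hv₀))
  -- Inverses are controlled too, so that the pointwise limit is a bijection and not merely an
  -- injection.
  have horb' : ∀ v : V, ((fun g : X.Aut => g • v) '' {g | g⁻¹ ∈ B}).Finite :=
    finite_orbit hfin _ (v := g₀ • v₀) ((Set.finite_singleton v₀).subset (by
      rintro _ ⟨g, hg, rfl⟩
      have := hg v₀ hv₀
      rw [inv_smul_eq_iff] at this
      exact this.symm))
  refine isCompact_iff_ultrafilter_le_nhds.2 fun 𝒰 h𝒰 => ?_
  have hB𝒰 : B ∈ 𝒰 := le_principal_iff.1 h𝒰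
  have hlim : ∀ v : V, ∃ w, ∀ᶠ g : X.Aut in 𝒰, g • v = w := by
    intro v
    have : (⋃ w ∈ (fun g : X.Aut => g • v) '' B, {g : X.Aut | g • v = w}) ∈ 𝒰 :=
      mem_of_superset hB𝒰 fun g hg => Set.mem_biUnion ⟨g, hg, rfl⟩ rfl
    obtain ⟨w, -, hw⟩ := (Ultrafilter.finite_biUnion_mem_iff (horb v)).1 this
    exact ⟨w, hw⟩
  have hlim' : ∀ v : V, ∃ w, ∀ᶠ g : X.Aut in 𝒰, g⁻¹ • v = w := by
    intro v
    have : (⋃ w ∈ (fun g : X.Aut => g • v) '' {g | g⁻¹ ∈ B}, {g : X.Aut | g⁻¹ • v = w}) ∈ 𝒰 :=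
      mem_of_superset hB𝒰 fun g hg =>
        Set.mem_biUnion ⟨g⁻¹, by simpa using hg, rfl⟩ rfl
    obtain ⟨w, -, hw⟩ := (Ultrafilter.finite_biUnion_mem_iff (horb' v)).1 this
    exact ⟨w, hw⟩
  choose φ hφ using hlim
  choose ψ hψ using hlim'
  let σ : Equiv.Perm V :=
    { toFun := φ
      invFun := ψ
      left_inv := fun v => by
        obtain ⟨g, h₁, h₂⟩ := ((hφ v).and (hψ (φ v))).exists
        rw [← h₂, ← h₁, inv_smul_smul]
      right_inv := fun v => by
        obtain ⟨g, h₁, h₂⟩ := ((hψ v).and (hφ (ψ v))).exists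
        rw [← h₂, ← h₁, smul_inv_smul] }
  have himage : ∀ C : Set V, C.Finite → (σ '' C ∈ X.cubes ↔ C ∈ X.cubes) := by
    intro C hC
    obtain ⟨g, hg⟩ := ((eventually_all_finite hC).2 fun v _ => hφ v).exists
    rw [← g.image_mem_iff C, Set.image_congr hg]
    rfl
  have hσ : σ ∈ X.autGroup := fun C =>
    ⟨fun h => (himage C ((finite_of_mem_cubes h).of_finite_image σ.injective.injOn)).1 h,
      fun h => (himage C (finite_of_mem_cubes h)).2 h⟩
  refine ⟨⟨σ, hσ⟩, fun v hv => ?_, le_nhds_of_eventually_smul_eq hfin hφ⟩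
  obtain ⟨g, h₁, h₂⟩ := ((hφ v).and (show ∀ᶠ g in (𝒰 : Filter X.Aut), g ∈ B from hB𝒰)).exists
  exact h₁.symm.trans (h₂ v hv)

/-- A subgroup of `Aut(X)` that contains the pointwise stabilizer of a finite nonempty set of
vertices is locally compact. -/
theorem locallyCompactSpace_subgroup (hfin : X.LocallyFinite) [PreconnectedSpace X.Realization]
    (H : Subgroup X.Aut) {K : Set V} (hKfin : K.Finite) (hK : K.Nonempty)
    (hH : ∀ g : X.Aut, (∀ v ∈ K, g • v = v) → g ∈ H) : LocallyCompactSpace H := by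
  have : WeaklyLocallyCompactSpace H := by
    refine ⟨fun g₀ => ⟨Subtype.val ⁻¹' {g : X.Aut | ∀ v ∈ K, g • v = (g₀ : X.Aut) • v}, ?_, ?_⟩⟩
    · have hsub : {g : X.Aut | ∀ v ∈ K, g • v = (g₀ : X.Aut) • v} ⊆
          Set.range (Subtype.val : H → X.Aut) := by
        intro g hg
        have := hH ((g₀ : X.Aut)⁻¹ * g) fun v hv => by
          rw [mul_smul, hg v hv, inv_smul_smul]
        exact ⟨⟨g, by simpa using mul_mem g₀.2 this⟩, rfl⟩
      rw [Subtype.isCompact_iff, Set.image_preimage_eq_of_subset hsub]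
      exact isCompact_setOf_eqOn hfin hK _
    · refine IsOpen.mem_nhds (IsOpen.preimage continuous_subtype_val ?_) fun v _ => rfl
      have : {g : X.Aut | ∀ v ∈ K, g • v = (g₀ : X.Aut) • v} =
          ⋂ v ∈ K, {g : X.Aut | g • v = (g₀ : X.Aut) • v} := by
        ext
        simp
      rw [this]
      exact hKfin.isOpen_biInter fun v _ => isOpen_setOf_smul_eq v _
  -- `Aut` is Hausdorff, so one compact neighbourhood of each point suffices.
  infer_instance

end Aut

end CubeComplex

theorem mainTheorem8 {V : Type*} (X : CubeComplex V) (hfin : X.LocallyFinite) (hcat : X.IsCAT0)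
    {S : Type*} [Finite S] [InvolutiveInv S] (hinv : ∀ s : S, s⁻¹ ≠ s)
    (ℓ : X.OEdge → S) (hadm : CubeComplex.IsAdmissible ℓ)
    {Γ : Type*} [Group Γ] (ρ : Γ →* X.Aut)
    (hℓ : ∀ (γ : Γ) (e : X.OEdge), ℓ ((ρ γ).mapEdge e) = ℓ e)
    (htrans : ∀ v w : V, ∃ γ : Γ, ρ γ • v = w)
    (hs : ∃ s : S, (∃ e : X.OEdge, ℓ e = s) ∧
      ∀ t r : S, t ≠ r → CubeComplex.LabelsCommute ℓ s t → CubeComplex.LabelsCommute ℓ s r →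
        t = r⁻¹ ∨ CubeComplex.LabelsCommute ℓ t r) :
    LocallyCompactSpace X.AutPlus ∧
      ∃ K : Set V, K.Finite ∧ ∀ g : X.Aut, (∀ v ∈ K, g • v = v) → g ∈ X.AutPlus := by
  have := hcat.simplyConnected
  obtain ⟨_, ⟨e, rfl⟩, hs⟩ := hs
  simp only [hadm.labelsCommute_iff] at hs
  have hhom := hadm.isHomogeneous ρ hℓ htrans
  let K : Set V := insert e.fst {w | X.skeleton.Adj e.fst w}
  have hKfin : K.Finite := (hfin.finite_neighbors e.fst).insert e.fst
  have hK : ∀ g : X.Aut, (∀ v ∈ K, g • v = v) → g ∈ X.AutPlus := by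
    intro g hg
    have hfix : CubeComplex.FixesCarrierAt ℓ (ℓ e) g e.fst :=
      ⟨hg _ (Set.mem_insert _ _), fun f hf _ => hg _ (Set.mem_insert_of_mem _ (hf ▸ f.adj))⟩
    exact CubeComplex.mem_autPlus_of_fixes_hyperplane e g fun f hf =>
      hfix.smul_eq_of_sameHyperplane hadm hhom hs hf
  exact ⟨CubeComplex.Aut.locallyCompactSpace_subgroup hfin _ hKfin ⟨_, Set.mem_insert _ _⟩ hK,
    K, hKfin, hK⟩
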